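/- **Setting.** Let $\mathcal L$ be a finite set of links with capacities $c^l>0$. There are finitely many agents, divided into groups $k\in\mathcal K=\{1,\dots,K\}$; agent $ki$ is the $i$-th agent of group $k$, and it uses a nonempty set $\mathcal L_{ki}\subseteq\mathcal L$ of links, with weights $\alpha^l_{ki}>0$ ($l\in\mathcal L_{ki}$). Let $\mathcal G^l_k$ be the set of agents of group $k$ using link $l$, $G_k^l=|\mathcal G_k^l|$, $\mathcal K^l=\{k:\mathcal G_k^l\neq\emptyset\}$, $K^l=|\mathcal K^l|$, and for $z\ge 0$ let $S^l(z)=\{k\in\mathcal K^l:\ z_{ki}>0\text{ for some }i\in\mathcal G^l_k\}$. Each agent has a valuation $v_{ki}:[0,\infty)\to\mathbb R$ that is strictly increasing, strictly concave and twice continuously differentiable on $[0,\infty)$ (so $v_{ki}'(0)$ is finite). The centralised problem is $$\text{(CP)}\quad \max_{x,m}\ \sum_{ki} v_{ki}(x_{ki})\quad\text{s.t.}\quad x_{ki}\ge 0,\quad \sum_{k\in\mathcal K^l} m_k^l\le c^l\ \ \forall l,\quad \alpha^l_{ki}x_{ki}\le m^l_k\ \ \forall l,\ k\in\mathcal K^l,\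 i\in\mathcal G_k^l .$$ Assume $K^l\ge 2$ for every link $l$, and $|S^l(x^\star)|\ge 2$ for every link $l$ at an optimal allocation $x^\star$ of (CP). **Mechanism.** Let $\eta,\xi>0$. Agent $ki$ announces a demand $y_{ki}\ge0$ and prices ${}^1q^l_{ki},{}^2q^l_{ki}\ge 0$ for $l\in\mathcal L_{ki}$. Put $n^l_k=\max_{i\in\mathcal G^l_k}\alpha^l_{ki}y_{ki}$. If $y=0$ then $x=0$ and $m=0$; otherwise $x_{ki}=r\,y_{ki}$ and $m^l_k=r\,n^l_k$, where $r=\min_l r^l$ and $$r^l=\begin{cases} \dfrac{c^l}{\sum_{k\in\mathcal K^l}n^l_k}, & |S^l(y)|\ge2,\\[2mm] \dfrac{c^l}{\sum_{k'\in\mathcal K^l}n^l_{k'}}-\dfrac{c^l}{n^l_k(n^l_k+1)}, & S^l(y)=\{k\},\\[1mm] +\infty, & S^l(y)=\emptyset.\end{cases}$$ Let $w^l_k=\sum_{i\in\mathcal G^l_k}{}^1q^l_{ki}$ and $\bar w^l_{-k}=\frac1{K^l-1}\sum_{k'\in\mathcal K^l\setminus\{k\}}w^l_{k'}$. The tax is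 $t_{ki}=\sum_{l\in\mathcal L_{ki}}t^l_{ki}$. If $G_k^l\ge2$, let $kj$ and $ke$ be the cyclic predecessor and the cyclic successor of $ki$ in $\mathcal G^l_k$ (ordered by index); then $$t^l_{ki}=x_{ki}\alpha^l_{ki}\,{}^2q^l_{kj}+({}^2q^l_{ki}-{}^1q^l_{ke})^2+(w^l_k-\bar w^l_{-k})^2+\eta\,{}^2q^l_{kj}({}^1q^l_{ki}-{}^2q^l_{kj})(m^l_k-\alpha^l_{ki}x_{ki})+\xi\,\bar w^l_{-k}(w^l_k-\bar w^l_{-k})\Big(c^l-\sum_{k'\in\mathcal K^l}m^l_{k'}\Big).$$ If $G_k^l=1$, then $t^l_{ki}$ is the same expression with the second summand omitted and ${}^2q^l_{kj}$ replaced by $\bar w^l_{-k}$. In the game $\mathfrak G$ the utility of agent $ki$ is $\hat u_{ki}=v_{ki}(x_{ki})-t_{ki}$. **Theorem.** (CP) has a solution, and the optimal allocation $x^\star$ is unique. Moreover: 1. For all $\eta,\xi>0$, every pure-strategy Nash equilibrium of $\mathfrak G$ yields the allocation $x=x^\star$; at every such equilibrium, individual rationality holds for all agents, $\hat u_{ki}\ge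 v_{ki}(0)$, and weak budget balance, i.e. individual rationality for the seller, holds: $\sum_{ki}t_{ki}\ge 0$. 2. If $v_{ki}''(x^\star_{ki})<0$ for all agents $ki$ (one-sided second derivative if $x^\star_{ki}=0$), then there is $\varepsilon>0$ (depending on the network and the valuations) such that for all $\eta,\xi\in(0,\varepsilon)$ the game $\mathfrak G$ has a pure-strategy Nash equilibrium. -/

import Mathlib

/-- A multi-rate multicast network over a finite set `Λ` of links: `K` groups, group `k` consisting
of the agents `(k, i)`, `i : Fin (G k)`; every agent has a nonempty route; the weights (for the
links on a route) and the capacities are positive. -/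
structure MulticastNetwork (Λ : Type*) where
  K : ℕ
  G : Fin K → ℕ
  route : (Σ k : Fin K, Fin (G k)) → Finset Λ
  route_nonempty : ∀ a, (route a).Nonempty
  α : Λ → (Σ k : Fin K, Fin (G k)) → ℝ
  α_pos : ∀ a, ∀ l ∈ route a, 0 < α l a
  c : Λ → ℝ
  c_pos : ∀ l, 0 < c l

namespace MulticastNetwork

variable {Λ : Type*}

/-- Agents `(k, i)`. -/
abbrev Agent (N : MulticastNetwork Λ) : Type := Σ k : Fin N.K, Fin (N.G k)

/-- Admissible valuations on `ℝ₊ = [0, ∞)`: strictly increasing, strictly concave, twice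
continuously differentiable up to (and including) the end point `0`; in particular the one-sided
derivative at `0` exists and is finite. Only the values on `[0, ∞)` matter. -/
def IsValuation (f : ℝ → ℝ) : Prop :=
  StrictMonoOn f (Set.Ici 0) ∧ StrictConcaveOn ℝ (Set.Ici 0) f ∧ ContDiffOn ℝ 2 f (Set.Ici 0)

/-- Second derivative of a function on `[0, ∞)` (one-sided at `0`). -/
noncomputable def secondDeriv (f : ℝ → ℝ) (x : ℝ) : ℝ :=
  derivWithin (derivWithin f (Set.Ici 0)) (Set.Ici 0) x

section Network

variable [DecidableEq Λ] (N : MulticastNetwork Λ)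

/-- `G_k^l`: the agents of group `k` that use link `l`. -/
def members (l : Λ) (k : Fin N.K) : Finset (Fin (N.G k)) :=
  Finset.univ.filter fun i => l ∈ N.route ⟨k, i⟩

/-- `K^l`: the groups with at least one agent on link `l`. -/
def groupsOn (l : Λ) : Finset (Fin N.K) :=
  Finset.univ.filter fun k => (N.members l k).Nonempty

/-- `S^l(z)`: the groups on link `l` in which some agent using `l` has a positive component. -/
noncomputable def support (l : Λ) (z : N.Agent → ℝ) : Finset (Fin N.K) :=
  open Classical in (N.groupsOn l).filter fun k => ∃ i ∈ N.members l k, 0 < z ⟨k, i⟩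

/-- The weighted maximum `max_{i ∈ G_k^l} α_{ki}^l z_{ki}` (it is used for `k ∈ K^l` only). -/
noncomputable def groupMax (l : Λ) (k : Fin N.K) (z : N.Agent → ℝ) : ℝ :=
  if h : (N.members l k).Nonempty then
    (N.members l k).sup' h fun i => N.α l ⟨k, i⟩ * z ⟨k, i⟩
  else 0

/-! ### The centralised problem -/

/-- Social welfare. -/
def welfare (v : N.Agent → ℝ → ℝ) (x : N.Agent → ℝ) : ℝ := ∑ a, v a (x a)

/-- Feasible rates: nonnegative, and on each link the sum of the weighted group maxima is at most
the capacity. -/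
def FeasibleRates (x : N.Agent → ℝ) : Prop :=
  (∀ a, 0 ≤ x a) ∧ ∀ l, ∑ k ∈ N.groupsOn l, N.groupMax l k x ≤ N.c l

/-- `x` solves the centralised problem in the rates alone. -/
def IsOptimalRates (v : N.Agent → ℝ → ℝ) (x : N.Agent → ℝ) : Prop :=
  N.FeasibleRates x ∧ ∀ x', N.FeasibleRates x' → N.welfare v x' ≤ N.welfare v x

/-- Feasibility for the centralised problem with auxiliary variables `m_k^l`. -/
def Feasible (x : N.Agent → ℝ) (m : Λ → Fin N.K → ℝ) : Prop :=
  (∀ a, 0 ≤ x a) ∧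
  (∀ l, ∑ k ∈ N.groupsOn l, m l k ≤ N.c l) ∧
  (∀ l, ∀ k ∈ N.groupsOn l, ∀ i ∈ N.members l k, N.α l ⟨k, i⟩ * x ⟨k, i⟩ ≤ m l k)

/-- `(x, m)` solves the centralised problem with auxiliary variables. -/
def IsOptimal (v : N.Agent → ℝ → ℝ) (x : N.Agent → ℝ) (m : Λ → Fin N.K → ℝ) : Prop :=
  N.Feasible x m ∧ ∀ x' m', N.Feasible x' m' → N.welfare v x' ≤ N.welfare v x

/-! ### Cyclic order of the members of a group on a link -/

/-- Position (counted from `0`) of `i` among the members of group `k` on link `l`. -/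
def position (l : Λ) (k : Fin N.K) (i : Fin (N.G k)) : ℕ :=
  ((N.members l k).filter fun j => j < i).card

/-- The member of group `k` on link `l` at a given position (modulo `G_k^l`). The default `i` is
returned only if there is no member. -/
def memberAt (l : Λ) (k : Fin N.K) (i : Fin (N.G k)) (p : ℕ) : Fin (N.G k) :=
  if h : 0 < (N.members l k).card then
    (N.members l k).orderEmbOfFin rfl ⟨p % (N.members l k).card, Nat.mod_lt p h⟩
  else i

/-- The cyclic successor of `i` on link `l` within group `k`. -/
def next (l : Λ) (k : Fin N.K) (i : Fin (N.G k)) : Fin (N.G k) :=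
  N.memberAt l k i (N.position l k i + 1)

/-- The cyclic predecessor of `i` on link `l` within group `k`. -/
def prev (l : Λ) (k : Fin N.K) (i : Fin (N.G k)) : Fin (N.G k) :=
  N.memberAt l k i (N.position l k i + (N.members l k).card - 1)

end Network

/-! ### Messages -/

/-- The action set of agent `a`: a demand and, for each link on the route of `a`, two prices, all of
them nonnegative. -/
structure Message (N : MulticastNetwork Λ) (a : N.Agent) where
  demand : NNReal
  price₁ : {l // l ∈ N.route a} → NNReal
  price₂ : {l // l ∈ N.route a} → NNReal

/-- Action profiles. -/
abbrev Profile (N : MulticastNetwork Λ) := (a : N.Agent) → N.Message a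

section Mechanism

variable [DecidableEq Λ] (N : MulticastNetwork Λ)

/-- The demand vector `y`. -/
def demands (s : N.Profile) (a : N.Agent) : ℝ := (s a).demand

/-- `¹q_a^l` (used for `l ∈ L_a` only). -/
def q₁ (s : N.Profile) (l : Λ) (a : N.Agent) : ℝ :=
  if h : l ∈ N.route a then (s a).price₁ ⟨l, h⟩ else 0

/-- `²q_a^l` (used for `l ∈ L_a` only). -/
def q₂ (s : N.Profile) (l : Λ) (a : N.Agent) : ℝ :=
  if h : l ∈ N.route a then (s a).price₂ ⟨l, h⟩ else 0

/-! ### Proportional allocation -/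

/-- `f^l(n) = c^l / (n (n + 1))`. -/
noncomputable def scaleCorrection (l : Λ) (n : ℝ) : ℝ := N.c l / (n * (n + 1))

/-- The scaling factor `r^l` of a link with `|S^l(y)| ≥ 1`. If `S^l(y) = {k}`, the sum over `S^l(y)`
is the single term `f^l(n_k^l)`. -/
noncomputable def linkScale (y : N.Agent → ℝ) (l : Λ) : ℝ :=
  if 2 ≤ (N.support l y).card then
    N.c l / ∑ k ∈ N.groupsOn l, N.groupMax l k y
  else
    N.c l / ∑ k ∈ N.groupsOn l, N.groupMax l k y
      - ∑ k ∈ N.support l y, N.scaleCorrection l (N.groupMax l k y)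

variable [Fintype Λ]

/-- The links with `|S^l(y)| ≥ 1`. -/
noncomputable def activeLinks (y : N.Agent → ℝ) : Finset Λ :=
  open Classical in Finset.univ.filter fun l => (N.support l y).Nonempty

/-- The scaling factor `r = min_l r^l`. Links with `|S^l(y)| = 0` have `r^l = +∞` and do not
contribute to the minimum. No link is active exactly if `y = 0`; the value `0` then makes the
allocation zero. -/
noncomputable def scale (y : N.Agent → ℝ) : ℝ :=
  if h : (N.activeLinks y).Nonempty then (N.activeLinks y).inf' h (N.linkScale y) else 0

/-- The allocation `x_a = r y_a`. -/
noncomputable def alloc (s : N.Profile) (a : N.Agent) : ℝ :=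
  N.scale (N.demands s) * N.demands s a

/-- `m_k^l = r n_k^l`. -/
noncomputable def groupRate (s : N.Profile) (l : Λ) (k : Fin N.K) : ℝ :=
  N.scale (N.demands s) * N.groupMax l k (N.demands s)

/-! ### Taxes -/

/-- The total price `w_k^l` quoted by group `k` on link `l`. -/
def groupPrice (s : N.Profile) (l : Λ) (k : Fin N.K) : ℝ :=
  ∑ i ∈ N.members l k, N.q₁ s l ⟨k, i⟩

/-- The average of the total prices of the other groups on link `l`. -/
noncomputable def otherPrice (s : N.Profile) (l : Λ) (k : Fin N.K) : ℝ :=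
  (∑ k' ∈ (N.groupsOn l).erase k, N.groupPrice s l k') / (((N.groupsOn l).erase k).card : ℝ)

/-- Unused capacity `c^l - ∑_k m_k^l`. -/
noncomputable def slack (s : N.Profile) (l : Λ) : ℝ :=
  N.c l - ∑ k ∈ N.groupsOn l, N.groupRate s l k

/-- The tax component `t_{ki}^l` of agent `(k, i)` for a link `l` on its route. -/
noncomputable def linkTax (η ξ : ℝ) (s : N.Profile) (l : Λ) (k : Fin N.K) (i : Fin (N.G k)) : ℝ :=
  if 2 ≤ (N.members l k).card then
    N.alloc s ⟨k, i⟩ * N.α l ⟨k, i⟩ * N.q₂ s l ⟨k, N.prev l k i⟩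
      + (N.q₂ s l ⟨k, i⟩ - N.q₁ s l ⟨k, N.next l k i⟩) ^ 2
      + (N.groupPrice s l k - N.otherPrice s l k) ^ 2
      + η * N.q₂ s l ⟨k, N.prev l k i⟩ * (N.q₁ s l ⟨k, i⟩ - N.q₂ s l ⟨k, N.prev l k i⟩)
          * (N.groupRate s l k - N.α l ⟨k, i⟩ * N.alloc s ⟨k, i⟩)
      + ξ * N.otherPrice s l k * (N.groupPrice s l k - N.otherPrice s l k) * N.slack s l
  else
    N.alloc s ⟨k, i⟩ * N.α l ⟨k, i⟩ * N.otherPrice s l k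
      + (N.groupPrice s l k - N.otherPrice s l k) ^ 2
      + η * N.otherPrice s l k * (N.q₁ s l ⟨k, i⟩ - N.otherPrice s l k)
          * (N.groupRate s l k - N.α l ⟨k, i⟩ * N.alloc s ⟨k, i⟩)
      + ξ * N.otherPrice s l k * (N.groupPrice s l k - N.otherPrice s l k) * N.slack s l

/-- The total tax of an agent. -/
noncomputable def tax (η ξ : ℝ) (s : N.Profile) (a : N.Agent) : ℝ :=
  ∑ l ∈ N.route a, N.linkTax η ξ s l a.1 a.2

/-! ### The game -/

/-- The utility of agent `a` in the game induced by the mechanism. -/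
noncomputable def utility (v : N.Agent → ℝ → ℝ) (η ξ : ℝ) (s : N.Profile) (a : N.Agent) : ℝ :=
  v a (N.alloc s a) - N.tax η ξ s a

/-- Pure-strategy Nash equilibria: no agent gains by a unilateral deviation. -/
def IsNash (v : N.Agent → ℝ → ℝ) (η ξ : ℝ) (s : N.Profile) : Prop :=
  ∀ (a : N.Agent) (b : N.Message a),
    N.utility v η ξ (Function.update s a b) a ≤ N.utility v η ξ s a

end Mechanism

end MulticastNetwork

/-! Both halves of the theorem go through the Karush–Kuhn–Tucker system `IsKKT`: link prices `w`,
split within each group into individual shares `μ`, such that each rate maximises `v a t - unitPrice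
* t` and complementary slackness holds for capacities and for the coupling within groups.

Equilibria are optimal. Changing only the prices for one link affects neither the allocation nor the
other taxes, so at an equilibrium each link tax is minimal in the agent's own prices. The second
price then equals the successor's first price. If a group price exceeded the average of the others,
its first-order condition would force it to be zero, which is absurd; since group prices and these
averages have the same sum, all of them agree on a link. What remains of the first-order conditions
is complementary slackness, and for every demand of a single agent its tax is now linear in its
rate. The agent is a price taker: it can move its rate slightly in either direction (downwards only
from a positive rate), and by concavity its rate is globally best at these prices. So `IsKKT` holds,
the allocation is optimal by weak duality, and strict concavity makes it unique. Individual
rationality is comparison with rate zero; budget balance is nonnegativity of price times rate.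

Equilibria exist. Slater's condition yields multipliers at the optimum, and the candidate
`profileOf` announces the optimal rates and the shares. The optimum is not rescaled, because it
saturates some link. If an agent deviates and its rate changes by `Δ`, then the share times the
group gap and the link price times the slack are `O(|Δ|)`: by complementary slackness each product
either vanishes identically or starts from a tight constraint. Optimising over the announced price
saves at most the square of a combination of these terms with coefficients `η` and `ξ`, hence at
most `C ε² Δ²`. The negative second derivative gives a loss of at least `κ Δ²`, which dominates for
small `ε`. -/

/-! ### Convex analysis: multipliers and quadratic growth. -/

open Set in
/-- Lagrange multipliers for a concave programme satisfying Slater's condition. -/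
theorem exists_lagrange_multipliers {E ι : Type*} [AddCommGroup E] [Module ℝ E] [Fintype ι]
    {X : Set E} {f : E → ℝ} {g : ι → E → ℝ} {p : ℝ} (hf : ConcaveOn ℝ X f)
    (hg : ∀ i, ConvexOn ℝ X (g i)) {x₀ : E} (hx₀ : x₀ ∈ X) (hslater : ∀ i, g i x₀ < 0)
    (hp : ∀ x ∈ X, (∀ i, g i x ≤ 0) → f x ≤ p) :
    ∃ μ : ι → ℝ, (∀ i, 0 ≤ μ i) ∧ ∀ x ∈ X, f x - ∑ i, μ i * g i x ≤ p := by
  classical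
  -- `D` consists of the (constraint, value) pairs that would beat `p` strictly; `C` consists of the
  -- attainable pairs, closed upwards in the constraints and downwards in the value. They are
  -- disjoint by `hp`, and a separating functional supplies the multipliers.
  let D : Set ((ι → ℝ) × ℝ) := {u | (∀ i, u.1 i < 0) ∧ p < u.2}
  let C : Set ((ι → ℝ) × ℝ) := {u | ∃ x ∈ X, (∀ i, g i x ≤ u.1 i) ∧ u.2 ≤ f x}
  have hDo : IsOpen D := by
    have : D = (⋂ i, {u : (ι → ℝ) × ℝ | u.1 i < 0}) ∩ {u | p < u.2} := by
      ext u; simp [D]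
    rw [this]
    refine IsOpen.inter (isOpen_iInter_of_finite fun i => ?_) ?_
    · exact isOpen_lt (by fun_prop) continuous_const
    · exact isOpen_lt continuous_const continuous_snd
  have hDc : Convex ℝ D := by
    rintro u ⟨hu1, hu2⟩ w ⟨hw1, hw2⟩ s t hs ht hst
    have key : ∀ q a b : ℝ, a < q → b < q → s * a + t * b < q := fun q a b ha hb =>
      (convex_Iio q (x := a) ha (y := b) hb hs ht hst :)
    refine ⟨fun i => by simpa using key 0 _ _ (hu1 i) (hw1 i), ?_⟩
    have := key (-p) (-u.2) (-w.2) (by linarith) (by linarith)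
    simp only [Prod.snd_add, Prod.smul_snd, smul_eq_mul]
    linarith
  have hCc : Convex ℝ C := by
    rintro u ⟨x, hx, hx1, hx2⟩ w ⟨z, hz, hz1, hz2⟩ s t hs ht hst
    refine ⟨s • x + t • z, hf.1 hx hz hs ht hst, fun i => ?_, ?_⟩
    · refine ((hg i).2 hx hz hs ht hst).trans ?_
      simp only [Prod.fst_add, Prod.smul_fst, Pi.add_apply, Pi.smul_apply, smul_eq_mul]
      have := mul_le_mul_of_nonneg_left (hx1 i) hs
      have := mul_le_mul_of_nonneg_left (hz1 i) ht
      linarith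
    · refine le_trans ?_ (hf.2 hx hz hs ht hst)
      simp only [Prod.snd_add, Prod.smul_snd, smul_eq_mul]
      have := mul_le_mul_of_nonneg_left hx2 hs
      have := mul_le_mul_of_nonneg_left hz2 ht
      linarith
  have hdisj : Disjoint D C := by
    rw [Set.disjoint_left]
    rintro u ⟨hu1, hu2⟩ ⟨x, hx, hx1, hx2⟩
    have := hp x hx fun i => (hx1 i).trans (hu1 i).le
    linarith
  obtain ⟨φ, a, hD, hC⟩ := geometric_hahn_banach_open hDc hDo hCc hdisj
  let e : ι → ℝ := fun i => φ (Pi.single i 1, 0)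
  let τ : ℝ := φ (0, 1)
  have hφ : ∀ u : ι → ℝ, ∀ t : ℝ, φ (u, t) = ∑ i, u i * e i + t * τ := by
    intro u t
    have h1 : ((u, t) : (ι → ℝ) × ℝ)
        = ∑ i, u i • ((Pi.single i 1, 0) : (ι → ℝ) × ℝ) + t • ((0, 1) : (ι → ℝ) × ℝ) := by
      refine Prod.ext ?_ ?_
      · funext j
        simp [Prod.fst_sum, Finset.sum_apply, Pi.single_apply]
      · simp [Prod.snd_sum]
    rw [h1, map_add, map_sum]
    simp only [map_smul, smul_eq_mul, e, τ]
  have hmem : ∀ x ∈ X, ((fun i => g i x), f x) ∈ C := fun x hx =>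
    ⟨x, hx, fun _ => le_rfl, le_rfl⟩
  -- `C` contains a ray in each constraint direction; a negative coefficient would make the
  -- functional unbounded below on it.
  have he : ∀ i, 0 ≤ e i := by
    intro i
    by_contra! h
    have hb : ∀ T : ℝ, 0 ≤ T → a ≤ φ ((fun j => g j x₀), f x₀) + T * e i := by
      intro T hT
      have h2 := hC ((fun j => g j x₀) + T • Pi.single i 1, f x₀) ⟨x₀, hx₀, fun j => ?_, le_rfl⟩
      · have h3 : (((fun j => g j x₀) + T • Pi.single i 1, f x₀) : (ι → ℝ) × ℝ)
            = ((fun j => g j x₀), f x₀) + T • ((Pi.single i 1, 0) : (ι → ℝ) × ℝ) := by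
          simp
        rw [h3, map_add, map_smul, smul_eq_mul] at h2
        exact h2
      · by_cases hj : j = i
        · subst hj; simp [hT]
        · simp [Pi.single_eq_of_ne hj]
    have h0 := hb 0 le_rfl
    have h1 := hb ((φ ((fun j => g j x₀), f x₀) - a + 1) / (-e i)) (by
      apply div_nonneg <;> linarith)
    have h2 : (φ ((fun j => g j x₀), f x₀) - a + 1) / (-e i) * e i
      = -(φ ((fun j => g j x₀), f x₀) - a + 1) := by
      rw [div_neg, neg_mul, div_mul_cancel₀ _ h.ne]
    linarith
  have hfx0 : f x₀ ≤ p := hp x₀ hx₀ fun i => (hslater i).le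
  -- This is where Slater's condition enters: the points of `C` and `D` compared here share the
  -- constraint part `g x₀`, so the strict separation falls on the value coordinate.
  have hτ : τ < 0 := by
    have h1 := hC _ (hmem x₀ hx₀)
    have h2 := hD ((fun j => g j x₀), p + 1) ⟨hslater, by simp⟩
    rw [hφ] at h1 h2
    by_contra! h
    have := mul_le_mul_of_nonneg_right (show f x₀ ≤ p + 1 by linarith) h
    linarith
  have hlim : ∀ x ∈ X, p * τ ≤ ∑ i, g i x * e i + f x * τ := by
    intro x hx
    have h1 := hC _ (hmem x hx)
    rw [hφ] at h1
    refine le_trans ?_ h1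
    have h2 : ∀ δ : ℝ, 0 < δ → p * τ + δ * (-∑ i, e i + τ) ≤ a := by
      intro δ hδ
      have h3 := hD ((fun _ => -δ), p + δ) ⟨fun i => by simpa using hδ, by simpa using hδ⟩
      rw [hφ, ← Finset.mul_sum] at h3
      linarith
    have h4 : Filter.Tendsto (fun δ : ℝ => p * τ + δ * (-∑ i, e i + τ)) (nhdsWithin 0 (Ioi 0))
        (nhds (p * τ + 0 * (-∑ i, e i + τ))) := by
      apply Filter.Tendsto.mono_left _ nhdsWithin_le_nhds
      apply Continuous.tendsto
      fun_prop
    rw [zero_mul, add_zero] at h4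
    exact le_of_tendsto h4 (Filter.eventually_of_mem self_mem_nhdsWithin fun δ hδ => h2 δ hδ)
  refine ⟨fun i => e i / (-τ), fun i => div_nonneg (he i) (by linarith), fun x hx => ?_⟩
  have h1 := hlim x hx
  have h2 : ∑ i, e i / (-τ) * g i x = (∑ i, g i x * e i) / (-τ) := by
    rw [Finset.sum_div]
    exact Finset.sum_congr rfl fun i _ => by ring
  rw [h2, sub_le_iff_le_add, ← sub_le_iff_le_add', le_div_iff₀ (by linarith)]
  linarith

/-- A concave function with a maximiser around which it is strongly concave has quadratic growth
on every bounded interval. -/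
theorem exists_quadratic_growth {f : ℝ → ℝ} (hf : MulticastNetwork.IsValuation f) {x P : ℝ}
    (hx : 0 ≤ x) (h2 : MulticastNetwork.secondDeriv f x < 0)
    (hmax : ∀ t, 0 ≤ t → f t - P * t ≤ f x - P * x) (X : ℝ) :
    ∃ κ > 0, ∀ t, 0 ≤ t → t ≤ X → f t - P * t + κ * (t - x) ^ 2 ≤ f x - P * x := by
  obtain ⟨-, hconc, hC2⟩ := hf
  have hU : UniqueDiffOn ℝ (Set.Ici (0 : ℝ)) := uniqueDiffOn_Ici 0
  have hC1 : ContDiffOn ℝ 1 (derivWithin f (Set.Ici 0)) (Set.Ici 0) :=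
    hC2.derivWithin hU (by norm_num)
  have hcont : ContinuousOn (MulticastNetwork.secondDeriv f) (Set.Ici 0) :=
    hC1.continuousOn_derivWithin hU le_rfl
  -- The second derivative at `x` is `-4κ`, so by continuity it stays below `-2κ` nearby, and there
  -- `f + κ t²` is concave.
  set κ : ℝ := -MulticastNetwork.secondDeriv f x / 4 with hκ
  have hκ0 : 0 < κ := by rw [hκ]; linarith
  have hev : ∀ᶠ t in nhdsWithin x (Set.Ici 0),
      MulticastNetwork.secondDeriv f t < -2 * κ :=
    (hcont x hx).eventually_lt_const (by linarith)
  obtain ⟨δ, hδ, hball⟩ := Metric.mem_nhdsWithin_iff.mp hev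
  set U : Set ℝ := Metric.ball x δ ∩ Set.Ici 0 with hUdef
  have hUc : Convex ℝ U := (convex_ball x δ).inter (convex_Ici 0)
  have hint : ∀ t ∈ interior U, t ∈ Metric.ball x δ ∧ 0 < t := by
    intro t ht
    have : t ∈ interior (Metric.ball x δ) ∩ interior (Set.Ici 0) := by
      rw [← interior_inter]; exact ht
    rw [interior_Ici, Metric.isOpen_ball.interior_eq] at this
    exact this
  have hd1 : ∀ t, 0 < t → HasDerivAt f (derivWithin f (Set.Ici 0) t) t := fun t ht =>
    (((hC2.differentiableOn (by norm_num)) t ht.le).hasDerivWithinAt).hasDerivAt (Ici_mem_nhds ht)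
  have hd2 : ∀ t, 0 < t → HasDerivAt (derivWithin f (Set.Ici 0))
      (MulticastNetwork.secondDeriv f t) t := fun t ht =>
    (((hC1.differentiableOn (by norm_num)) t ht.le).hasDerivWithinAt).hasDerivAt (Ici_mem_nhds ht)
  have hφconc : ConcaveOn ℝ U (fun t => f t + κ * t ^ 2) := by
    refine concaveOn_of_hasDerivWithinAt2_nonpos hUc
      (f' := fun t => derivWithin f (Set.Ici 0) t + κ * (2 * t))
      (f'' := fun t => MulticastNetwork.secondDeriv f t + κ * 2) ?_ ?_ ?_ ?_
    · exact (hC2.continuousOn.mono Set.inter_subset_right).add (by fun_prop)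
    · intro t ht
      have h := (hd1 t (hint t ht).2).fun_add ((hasDerivAt_pow 2 t).const_mul κ)
      simpa using h.hasDerivWithinAt
    · intro t ht
      have h := (hd2 t (hint t ht).2).fun_add (((hasDerivAt_id t).const_mul 2).const_mul κ)
      simpa using h.hasDerivWithinAt
    · intro t ht
      have h : MulticastNetwork.secondDeriv f t < -2 * κ :=
        hball ⟨(hint t ht).1, (hint t ht).2.le⟩
      linarith
  have hxU : x ∈ U := ⟨Metric.mem_ball_self hδ, hx⟩
  have hloc : ∀ t ∈ U, f t - P * t + κ / 2 * (t - x) ^ 2 ≤ f x - P * x := by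
    intro t ht
    have h1 := hφconc.2 hxU ht (by norm_num : (0 : ℝ) ≤ 1 / 2) (by norm_num : (0 : ℝ) ≤ 1 / 2)
      (by norm_num)
    simp only [smul_eq_mul] at h1
    have ht0 : 0 ≤ t := ht.2
    -- Maximality is tested at the midpoint, where strong concavity gains `κ (t - x)² / 4` over the
    -- chord.
    have h3 := hmax (1 / 2 * x + 1 / 2 * t) (by positivity)
    nlinarith
  set ρ := δ / 2 with hρ
  have hρ0 : 0 < ρ := by positivity
  set L := |X| + |x| + ρ with hL
  have hL0 : 0 < L := by positivity
  have hρL : ρ / L ≤ 1 := (div_le_one hL0).mpr (by rw [hL]; linarith [abs_nonneg X, abs_nonneg x])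
  -- Beyond distance `ρ` concavity only propagates the loss linearly, as `κ ρ |t - x| / 2`; since
  -- `|t - x| ≤ L` on the interval, this is still quadratic with the factor `ρ / L`.
  refine ⟨κ / 2 * (ρ / L), by positivity, fun t ht htX => ?_⟩
  by_cases hclose : |t - x| ≤ ρ
  · have h1 := hloc t ⟨by rw [Metric.mem_ball, Real.dist_eq]; linarith, ht⟩
    have h3 : κ / 2 * (ρ / L) * (t - x) ^ 2 ≤ κ / 2 * (t - x) ^ 2 := by
      apply mul_le_mul_of_nonneg_right _ (sq_nonneg _)
      exact mul_le_of_le_one_right (by positivity) hρL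
    linarith
  · push Not at hclose
    have hd0 : 0 < |t - x| := hρ0.trans hclose
    set θ := ρ / |t - x| with hθ
    have hθ0 : 0 < θ := by positivity
    have hθ1 : θ ≤ 1 := (div_le_one hd0).mpr hclose.le
    set s := (1 - θ) * x + θ * t with hs
    have hsx : s - x = θ * (t - x) := by rw [hs]; ring
    have hsabs : |s - x| = ρ := by
      rw [hsx, abs_mul, abs_of_pos hθ0, hθ]; field_simp
    have hs0 : 0 ≤ s := by
      rw [hs]
      have : 0 ≤ 1 - θ := by linarith
      positivity
    have h1 := hloc s ⟨by rw [Metric.mem_ball, Real.dist_eq, hsabs]; linarith, hs0⟩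
    have h3 := hconc.concaveOn.2 (x := x) hx (y := t) ht (by linarith : 0 ≤ 1 - θ) hθ0.le
      (by ring)
    simp only [smul_eq_mul] at h3
    rw [← hs] at h3
    have h4 : (s - x) ^ 2 = ρ ^ 2 := by rw [← sq_abs, hsabs]
    rw [h4] at h1
    have h5 : θ * (f t - P * t) + κ / 2 * ρ ^ 2 ≤ θ * (f x - P * x) := by
      have : P * s = (1 - θ) * (P * x) + θ * (P * t) := by rw [hs]; ring
      linarith
    have hxL : |t - x| ≤ L := by
      have h6 : |t| ≤ |X| := by rw [abs_of_nonneg ht]; exact htX.trans (le_abs_self X)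
      have h7 : |t - x| ≤ |t| + |x| := abs_sub t x
      rw [hL]; linarith
    have h8 : θ * (κ / 2 * (ρ / L) * (t - x) ^ 2) ≤ κ / 2 * ρ ^ 2 := by
      have : θ * (κ / 2 * (ρ / L) * (t - x) ^ 2) = κ / 2 * ρ ^ 2 * (|t - x| / L) := by
        rw [← sq_abs (t - x), hθ]; field_simp
      rw [this]
      exact mul_le_of_le_one_right (by positivity) ((div_le_one hL0).mpr hxL)
    have h9 : θ * (f t - P * t + κ / 2 * (ρ / L) * (t - x) ^ 2) ≤ θ * (f x - P * x) := by
      rw [mul_add]; linarith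
    exact le_of_mul_le_mul_left h9 hθ0

namespace MulticastNetwork

/-! ### Group maxima and link loads, and their dependence on one demand. -/

section Update

variable {Λ : Type*} (N : MulticastNetwork Λ) {z : N.Agent → ℝ} (a : N.Agent)

theorem update_nonneg (hz : ∀ b, 0 ≤ z b) {y : ℝ} (hy : 0 ≤ y) (b : N.Agent) :
    0 ≤ Function.update z a y b := by
  by_cases hb : b = a
  · rw [hb, Function.update_self]; exact hy
  · rw [Function.update_of_ne hb]; exact hz b

theorem update_pos_iff {y₁ y₂ : ℝ} (h₁ : 0 < y₁) (h₂ : 0 < y₂) (b : N.Agent) :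
    0 < Function.update z a y₁ b ↔ 0 < Function.update z a y₂ b := by
  by_cases hb : b = a
  · rw [hb, Function.update_self, Function.update_self]; exact iff_of_true h₁ h₂
  · rw [Function.update_of_ne hb, Function.update_of_ne hb]

end Update

section Loads

variable {Λ : Type*} [DecidableEq Λ] (N : MulticastNetwork Λ)

theorem mem_members {l : Λ} {k : Fin N.K} {i : Fin (N.G k)} :
    i ∈ N.members l k ↔ l ∈ N.route ⟨k, i⟩ := by
  simp [members]

theorem mem_groupsOn {l : Λ} {k : Fin N.K} :
    k ∈ N.groupsOn l ↔ (N.members l k).Nonempty := by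
  simp [groupsOn]

theorem mem_groupsOn_of_mem_route {l : Λ} {a : N.Agent} (h : l ∈ N.route a) :
    a.1 ∈ N.groupsOn l :=
  N.mem_groupsOn.mpr ⟨a.2, N.mem_members.mpr h⟩

theorem mem_support {l : Λ} {z : N.Agent → ℝ} {k : Fin N.K} :
    k ∈ N.support l z ↔ k ∈ N.groupsOn l ∧ ∃ i ∈ N.members l k, 0 < z ⟨k, i⟩ := by
  classical
  simp [support]

theorem le_groupMax {l : Λ} {k : Fin N.K} {i : Fin (N.G k)} (hi : i ∈ N.members l k)
    (z : N.Agent → ℝ) : N.α l ⟨k, i⟩ * z ⟨k, i⟩ ≤ N.groupMax l k z := by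
  rw [groupMax, dif_pos ⟨i, hi⟩]
  exact Finset.le_sup' (fun i => N.α l ⟨k, i⟩ * z ⟨k, i⟩) hi

theorem groupMax_le {l : Λ} {k : Fin N.K} (hk : k ∈ N.groupsOn l) {z : N.Agent → ℝ} {b : ℝ}
    (h : ∀ i ∈ N.members l k, N.α l ⟨k, i⟩ * z ⟨k, i⟩ ≤ b) : N.groupMax l k z ≤ b := by
  rw [groupMax, dif_pos (N.mem_groupsOn.mp hk)]
  exact Finset.sup'_le _ _ h

theorem α_pos_of_mem {l : Λ} {k : Fin N.K} {i : Fin (N.G k)} (hi : i ∈ N.members l k) :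
    0 < N.α l ⟨k, i⟩ :=
  N.α_pos _ _ (N.mem_members.mp hi)

theorem groupMax_nonneg (l : Λ) (k : Fin N.K) {z : N.Agent → ℝ} (hz : ∀ a, 0 ≤ z a) :
    0 ≤ N.groupMax l k z := by
  by_cases h : (N.members l k).Nonempty
  · obtain ⟨i, hi⟩ := h
    exact (mul_nonneg (N.α_pos_of_mem hi).le (hz _)).trans (N.le_groupMax hi z)
  · rw [groupMax, dif_neg h]

/-- Monotonicity and positive homogeneity of the weighted maximum in one inequality;
`groupMax_smul`, `groupMax_mono` and `mul_load_update_le` are instances of it. No sign is assumed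
for `w`, so `s = 0` has to be treated separately. -/
theorem mul_groupMax_le {l : Λ} {k : Fin N.K} (hk : k ∈ N.groupsOn l) {z w : N.Agent → ℝ}
    {s t : ℝ} (hs : 0 ≤ s) (ht : 0 ≤ t)
    (h : ∀ i ∈ N.members l k, s * z ⟨k, i⟩ ≤ t * w ⟨k, i⟩) :
    s * N.groupMax l k z ≤ t * N.groupMax l k w := by
  have hb : 0 ≤ t * N.groupMax l k w ∨ s ≠ 0 := by
    by_cases hs0 : s = 0
    · left
      obtain ⟨i, hi⟩ := N.mem_groupsOn.mp hk
      have h1 := h i hi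
      rw [hs0, zero_mul] at h1
      have h2 := mul_le_mul_of_nonneg_left (N.le_groupMax hi w) ht
      have h3 := mul_nonneg (N.α_pos_of_mem hi).le h1
      linarith
    · right; exact hs0
  rcases eq_or_lt_of_le hs with hs0 | hs0
  · rcases hb with hb | hb
    · rw [← hs0, zero_mul]; exact hb
    · exact absurd hs0.symm hb
  · rw [← le_div_iff₀' hs0]
    refine N.groupMax_le hk fun i hi => ?_
    rw [le_div_iff₀' hs0]
    have h2 := mul_le_mul_of_nonneg_left (N.le_groupMax hi w) ht
    have h3 := mul_le_mul_of_nonneg_left (h i hi) (N.α_pos_of_mem hi).le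
    linarith

theorem groupMax_smul {l : Λ} {k : Fin N.K} (hk : k ∈ N.groupsOn l) {z : N.Agent → ℝ} {r : ℝ}
    (hr : 0 ≤ r) : N.groupMax l k (fun a => r * z a) = r * N.groupMax l k z := by
  apply le_antisymm
  · simpa using N.mul_groupMax_le hk (z := fun a => r * z a) (w := z) zero_le_one hr
      fun i _ => by simp
  · simpa using N.mul_groupMax_le hk (z := z) (w := fun a => r * z a) hr zero_le_one
      fun i _ => by simp

theorem groupMax_mono {l : Λ} {k : Fin N.K} (hk : k ∈ N.groupsOn l) {z w : N.Agent → ℝ}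
    (h : ∀ i ∈ N.members l k, z ⟨k, i⟩ ≤ w ⟨k, i⟩) : N.groupMax l k z ≤ N.groupMax l k w := by
  simpa using N.mul_groupMax_le hk zero_le_one zero_le_one (by simpa using h)

theorem groupMax_pos_of_mem_support {l : Λ} {k : Fin N.K} {z : N.Agent → ℝ}
    (hk : k ∈ N.support l z) : 0 < N.groupMax l k z := by
  obtain ⟨-, i, hi, hpos⟩ := N.mem_support.mp hk
  exact (mul_pos (N.α_pos_of_mem hi) hpos).trans_le (N.le_groupMax hi z)

theorem groupMax_eq_zero_of_notMem_support {l : Λ} {k : Fin N.K} {z : N.Agent → ℝ}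
    (hz : ∀ a, 0 ≤ z a) (hk : k ∈ N.groupsOn l) (h : k ∉ N.support l z) :
    N.groupMax l k z = 0 := by
  refine le_antisymm (N.groupMax_le hk fun i hi => ?_) (N.groupMax_nonneg l k hz)
  by_contra! hpos
  exact h (N.mem_support.mpr ⟨hk, i, hi, pos_of_mul_pos_right hpos (N.α_pos_of_mem hi).le⟩)

/-- The total weighted demand on a link. -/
noncomputable def load (l : Λ) (z : N.Agent → ℝ) : ℝ := ∑ k ∈ N.groupsOn l, N.groupMax l k z

/-- The weighted demand on a link of the groups other than the group of `a`. -/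
noncomputable def otherLoad (l : Λ) (a : N.Agent) (z : N.Agent → ℝ) : ℝ :=
  ∑ k ∈ (N.groupsOn l).erase a.1, N.groupMax l k z

theorem load_nonneg (l : Λ) {z : N.Agent → ℝ} (hz : ∀ a, 0 ≤ z a) : 0 ≤ N.load l z :=
  Finset.sum_nonneg fun k _ => N.groupMax_nonneg l k hz

theorem otherLoad_nonneg (l : Λ) (a : N.Agent) {z : N.Agent → ℝ} (hz : ∀ a, 0 ≤ z a) :
    0 ≤ N.otherLoad l a z :=
  Finset.sum_nonneg fun k _ => N.groupMax_nonneg l k hz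

theorem otherLoad_le_load (l : Λ) (a : N.Agent) {z : N.Agent → ℝ} (hz : ∀ a, 0 ≤ z a) :
    N.otherLoad l a z ≤ N.load l z :=
  Finset.sum_le_sum_of_subset_of_nonneg (Finset.erase_subset _ _)
    fun k _ _ => N.groupMax_nonneg l k hz

theorem load_smul (l : Λ) {z : N.Agent → ℝ} {r : ℝ} (hr : 0 ≤ r) :
    N.load l (fun a => r * z a) = r * N.load l z := by
  rw [load, load, Finset.mul_sum]
  exact Finset.sum_congr rfl fun k hk => N.groupMax_smul hk hr

theorem load_pos {l : Λ} {z : N.Agent → ℝ} (hz : ∀ a, 0 ≤ z a) (h : (N.support l z).Nonempty) :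
    0 < N.load l z := by
  obtain ⟨k, hk⟩ := h
  exact Finset.sum_pos' (fun k _ => N.groupMax_nonneg l k hz)
    ⟨k, (N.mem_support.mp hk).1, N.groupMax_pos_of_mem_support hk⟩

theorem load_eq_zero {l : Λ} {z : N.Agent → ℝ} (hz : ∀ a, 0 ≤ z a)
    (h : ¬ (N.support l z).Nonempty) : N.load l z = 0 :=
  Finset.sum_eq_zero fun k hk => N.groupMax_eq_zero_of_notMem_support hz hk
    fun hk' => h ⟨k, hk'⟩

theorem otherLoad_pos {l : Λ} {z : N.Agent → ℝ} (hz : ∀ a, 0 ≤ z a) (a : N.Agent)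
    (h : 2 ≤ (N.support l z).card) : 0 < N.otherLoad l a z := by
  obtain ⟨k, hk, hka⟩ := Finset.exists_mem_ne (Nat.lt_of_succ_le h) a.1
  exact Finset.sum_pos' (fun k _ => N.groupMax_nonneg l k hz)
    ⟨k, Finset.mem_erase.mpr ⟨hka, (N.mem_support.mp hk).1⟩, N.groupMax_pos_of_mem_support hk⟩

/-- The term added to the load in the denominator of the scaling factor when a single group has
positive demand. -/
noncomputable def offset (l : Λ) (z : N.Agent → ℝ) : ℝ :=
  if 2 ≤ (N.support l z).card then 0 else 1

theorem offset_nonneg (l : Λ) (z : N.Agent → ℝ) : 0 ≤ N.offset l z := by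
  rw [offset]; split_ifs <;> norm_num

/-- With a single active group, `c/n - c/(n(n+1)) = c/(n+1)`: the correction amounts to one extra
unit of load. This treats both cases of the mechanism by the same quotient. -/
theorem linkScale_eq {l : Λ} {z : N.Agent → ℝ} (hz : ∀ a, 0 ≤ z a)
    (h : (N.support l z).Nonempty) : N.linkScale z l = N.c l / (N.load l z + N.offset l z) := by
  have hpos := N.load_pos hz h
  rw [linkScale, offset]
  split_ifs with hc
  · rw [add_zero]; rfl
  · have h1 : (N.support l z).card = 1 := by
      have := h.card_pos
      omega
    obtain ⟨k, hk⟩ := Finset.card_eq_one.mp h1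
    have hk' : k ∈ N.support l z := by simp [hk]
    have h2 : N.load l z = N.groupMax l k z := by
      refine Finset.sum_eq_single_of_mem k (N.mem_support.mp hk').1 fun k' hk' hne => ?_
      refine N.groupMax_eq_zero_of_notMem_support hz hk' ?_
      simpa [hk] using hne
    rw [hk, Finset.sum_singleton, scaleCorrection, ← h2]
    change N.c l / N.load l z - _ = _
    field_simp
    ring

theorem load_add_offset_pos {l : Λ} {z : N.Agent → ℝ} (hz : ∀ a, 0 ≤ z a)
    (h : (N.support l z).Nonempty) : 0 < N.load l z + N.offset l z :=
  add_pos_of_pos_of_nonneg (N.load_pos hz h) (N.offset_nonneg l z)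

theorem support_mono {z w : N.Agent → ℝ} (h : ∀ a, 0 < z a → 0 < w a) (l : Λ) :
    N.support l z ⊆ N.support l w := by
  intro k hk
  obtain ⟨h1, i, hi, h2⟩ := N.mem_support.mp hk
  exact N.mem_support.mpr ⟨h1, i, hi, h _ h2⟩

theorem support_congr {z w : N.Agent → ℝ} (h : ∀ a, 0 < z a ↔ 0 < w a) (l : Λ) :
    N.support l z = N.support l w :=
  (N.support_mono (fun a => (h a).1) l).antisymm (N.support_mono (fun a => (h a).2) l)

theorem offset_congr {z w : N.Agent → ℝ} (h : ∀ a, 0 < z a ↔ 0 < w a) (l : Λ) :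
    N.offset l z = N.offset l w := by
  rw [offset, offset, N.support_congr h]

/-! ### Varying the demand of one agent -/

variable (z : N.Agent → ℝ) (a : N.Agent)

theorem groupMax_update_of_ne {l : Λ} {k : Fin N.K} (hk : k ≠ a.1) (y : ℝ) :
    N.groupMax l k (Function.update z a y) = N.groupMax l k z := by
  have : ∀ i : Fin (N.G k), Function.update z a y ⟨k, i⟩ = z ⟨k, i⟩ := fun i =>
    Function.update_of_ne (fun h => hk (by rw [← h])) _ _
  simp only [groupMax, this]

theorem otherLoad_update (l : Λ) (y : ℝ) :
    N.otherLoad l a (Function.update z a y) = N.otherLoad l a z :=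
  Finset.sum_congr rfl fun _ hk => N.groupMax_update_of_ne z a (Finset.mem_erase.mp hk).1 y

variable {z}

theorem load_update_mono (l : Λ) {y₁ y₂ : ℝ} (h : y₁ ≤ y₂) :
    N.load l (Function.update z a y₁) ≤ N.load l (Function.update z a y₂) :=
  Finset.sum_le_sum fun _ hk => N.groupMax_mono hk fun _ _ =>
    update_le_update_iff.mpr ⟨h, fun _ _ => le_rfl⟩ _

theorem groupMax_update_le {l : Λ} {k : Fin N.K} (hk : k ∈ N.groupsOn l)
    (hl : l ∈ N.route a) {y₁ y₂ : ℝ} (h : y₁ ≤ y₂) :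
    N.groupMax l k (Function.update z a y₂)
      ≤ N.groupMax l k (Function.update z a y₁) + N.α l a * (y₂ - y₁) := by
  refine N.groupMax_le hk fun i hi => ?_
  have h1 := N.le_groupMax hi (Function.update z a y₁)
  have hα := (N.α_pos a l hl).le
  by_cases hia : (⟨k, i⟩ : N.Agent) = a
  · rw [hia, Function.update_self] at h1 ⊢
    linarith
  · rw [Function.update_of_ne hia] at h1 ⊢
    have := mul_nonneg hα (sub_nonneg.mpr h)
    linarith

theorem exists_load_update_le (l : Λ) : ∃ A : ℝ, 0 ≤ A ∧ ∀ y₁ y₂ : ℝ, y₁ ≤ y₂ →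
    N.load l (Function.update z a y₂) ≤ N.load l (Function.update z a y₁) + A * (y₂ - y₁) := by
  by_cases hl : l ∈ N.route a
  · have hα := (N.α_pos a l hl).le
    refine ⟨N.α l a, hα, fun y₁ y₂ h => ?_⟩
    have ha := N.mem_groupsOn_of_mem_route hl
    rw [load, load, ← Finset.add_sum_erase _ _ ha, ← Finset.add_sum_erase _ _ ha]
    have h1 := N.groupMax_update_le (z := z) a ha hl h
    have h2 := N.otherLoad_update z a l y₁
    rw [← N.otherLoad_update z a l y₂] at h2
    rw [otherLoad, otherLoad] at h2
    linarith
  · refine ⟨0, le_rfl, fun y₁ y₂ _ => ?_⟩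
    rw [zero_mul, add_zero]
    refine Finset.sum_le_sum fun k hk => N.groupMax_mono hk fun i hi => ?_
    have : (⟨k, i⟩ : N.Agent) ≠ a := by
      rintro rfl
      exact hl (N.mem_members.mp hi)
    rw [Function.update_of_ne this, Function.update_of_ne this]

/-- The own group's maximum grows at most proportionally to the demand, while the other groups do
not react at all; hence load per unit of own demand falls, by an amount governed by `otherLoad`.
This is the quantitative source of strict monotonicity of the rate and of the deviation bounds. -/
theorem mul_load_update_le (hz : ∀ b, 0 ≤ z b) (l : Λ) {y₁ y₂ : ℝ} (h0 : 0 ≤ y₁) (h : y₁ ≤ y₂) :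
    y₁ * N.load l (Function.update z a y₂) + (y₂ - y₁) * N.otherLoad l a z
      ≤ y₂ * N.load l (Function.update z a y₁) := by
  have key : ∀ k ∈ N.groupsOn l, y₁ * N.groupMax l k (Function.update z a y₂)
      + (if k = a.1 then 0 else (y₂ - y₁) * N.groupMax l k z)
      ≤ y₂ * N.groupMax l k (Function.update z a y₁) := by
    intro k hk
    by_cases hka : k = a.1
    · rw [if_pos hka, add_zero]
      refine N.mul_groupMax_le hk h0 (h0.trans h) fun i _ => ?_
      by_cases hia : (⟨k, i⟩ : N.Agent) = a
      · rw [hia, Function.update_self, Function.update_self, mul_comm]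
      · rw [Function.update_of_ne hia, Function.update_of_ne hia]
        exact mul_le_mul_of_nonneg_right h (hz _)
    · rw [if_neg hka, N.groupMax_update_of_ne z a hka, N.groupMax_update_of_ne z a hka]
      linarith
  have h1 := Finset.sum_le_sum key
  rw [Finset.sum_add_distrib, ← Finset.mul_sum, ← Finset.mul_sum] at h1
  have h2 : ∑ k ∈ N.groupsOn l, (if k = a.1 then 0 else (y₂ - y₁) * N.groupMax l k z)
      = (y₂ - y₁) * N.otherLoad l a z := by
    rw [otherLoad, Finset.mul_sum, ← Finset.filter_ne' (N.groupsOn l) a.1, Finset.sum_filter]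
    exact Finset.sum_congr rfl fun k _ => by by_cases hk : k = a.1 <;> simp [hk]
  rw [h2] at h1
  exact h1

/-- Either some other group is active on the link, or the offset is `1`. The correction in the
mechanism thus plays the role of a competing group, so that even a lone group faces a strictly
increasing rate. -/
theorem otherLoad_add_offset_pos (hz : ∀ b, 0 ≤ z b) (l : Λ) {y : ℝ} (hy : 0 ≤ y) :
    0 < N.otherLoad l a z + N.offset l (Function.update z a y) := by
  by_cases h : 2 ≤ (N.support l (Function.update z a y)).card
  · have := N.otherLoad_pos (N.update_nonneg a hz hy) a h
    rw [N.otherLoad_update] at this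
    exact add_pos_of_pos_of_nonneg this (N.offset_nonneg _ _)
  · rw [offset, if_neg h]
    have := N.otherLoad_nonneg l a hz
    linarith

end Loads

/-! ### The scaling factor and the rates an agent can reach. -/

section Scale

variable {Λ : Type*} [DecidableEq Λ] [Fintype Λ] (N : MulticastNetwork Λ)

theorem mem_activeLinks {z : N.Agent → ℝ} {l : Λ} :
    l ∈ N.activeLinks z ↔ (N.support l z).Nonempty := by
  classical
  simp [activeLinks]

theorem activeLinks_congr {z w : N.Agent → ℝ} (h : ∀ a, 0 < z a ↔ 0 < w a) :
    N.activeLinks z = N.activeLinks w := by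
  ext l
  rw [mem_activeLinks, mem_activeLinks, N.support_congr h]

theorem mem_activeLinks_of_pos {z : N.Agent → ℝ} {a : N.Agent} (ha : 0 < z a) {l : Λ}
    (hl : l ∈ N.route a) : l ∈ N.activeLinks z :=
  N.mem_activeLinks.mpr ⟨a.1, N.mem_support.mpr
    ⟨N.mem_groupsOn_of_mem_route hl, a.2, N.mem_members.mpr hl, ha⟩⟩

theorem activeLinks_nonempty {z : N.Agent → ℝ} {a : N.Agent} (ha : 0 < z a) :
    (N.activeLinks z).Nonempty := by
  obtain ⟨l, hl⟩ := N.route_nonempty a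
  exact ⟨l, N.mem_activeLinks_of_pos ha hl⟩

theorem scale_le {z : N.Agent → ℝ} (hz : ∀ a, 0 ≤ z a) {l : Λ} (hl : l ∈ N.activeLinks z) :
    N.scale z ≤ N.c l / (N.load l z + N.offset l z) := by
  rw [scale, dif_pos ⟨l, hl⟩, ← N.linkScale_eq hz (N.mem_activeLinks.mp hl)]
  exact Finset.inf'_le _ hl

theorem exists_scale_eq {z : N.Agent → ℝ} (hz : ∀ a, 0 ≤ z a) (h : (N.activeLinks z).Nonempty) :
    ∃ l ∈ N.activeLinks z, N.scale z = N.c l / (N.load l z + N.offset l z) := by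
  obtain ⟨l, hl, hle⟩ := Finset.exists_mem_eq_inf' h (N.linkScale z)
  refine ⟨l, hl, ?_⟩
  rw [scale, dif_pos h, hle, N.linkScale_eq hz (N.mem_activeLinks.mp hl)]

theorem scale_pos {z : N.Agent → ℝ} (hz : ∀ a, 0 ≤ z a) (h : (N.activeLinks z).Nonempty) :
    0 < N.scale z := by
  obtain ⟨l, hl, he⟩ := N.exists_scale_eq hz h
  rw [he]
  exact div_pos (N.c_pos l) (N.load_add_offset_pos hz (N.mem_activeLinks.mp hl))

theorem scale_nonneg {z : N.Agent → ℝ} (hz : ∀ a, 0 ≤ z a) : 0 ≤ N.scale z := by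
  by_cases h : (N.activeLinks z).Nonempty
  · exact (N.scale_pos hz h).le
  · rw [scale, dif_neg h]

theorem scale_mul_load_le {z : N.Agent → ℝ} (hz : ∀ a, 0 ≤ z a) (l : Λ) :
    N.scale z * N.load l z ≤ N.c l := by
  by_cases h : l ∈ N.activeLinks z
  · have hpos := N.load_add_offset_pos hz (N.mem_activeLinks.mp h)
    have h1 := N.scale_le hz h
    rw [le_div_iff₀ hpos, mul_add] at h1
    have := mul_nonneg (N.scale_nonneg hz) (N.offset_nonneg l z)
    linarith
  · rw [N.load_eq_zero hz (fun h' => h (N.mem_activeLinks.mpr h')), mul_zero]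
    exact (N.c_pos l).le

theorem feasibleRates_scale {z : N.Agent → ℝ} (hz : ∀ a, 0 ≤ z a) :
    N.FeasibleRates fun a => N.scale z * z a := by
  refine ⟨fun a => mul_nonneg (N.scale_nonneg hz) (hz a), fun l => ?_⟩
  have h1 := N.load_smul l (z := z) (N.scale_nonneg hz)
  exact h1.trans_le (N.scale_mul_load_le hz l)

theorem scale_mul_groupMax_le {z : N.Agent → ℝ} (hz : ∀ a, 0 ≤ z a) {l : Λ} {k : Fin N.K}
    (hk : k ∈ N.groupsOn l) : N.scale z * N.groupMax l k z ≤ N.c l := by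
  refine le_trans (mul_le_mul_of_nonneg_left ?_ (N.scale_nonneg hz)) (N.scale_mul_load_le hz l)
  exact Finset.single_le_sum (f := fun k => N.groupMax l k z)
    (fun k _ => N.groupMax_nonneg l k hz) hk

variable {z : N.Agent → ℝ} (a : N.Agent)

theorem scale_update_antitone (hz : ∀ b, 0 ≤ z b) {y₁ y₂ : ℝ} (h0 : 0 < y₁) (h : y₁ ≤ y₂) :
    N.scale (Function.update z a y₂) ≤ N.scale (Function.update z a y₁) := by
  have h2 := h0.trans_le h
  have hz1 := N.update_nonneg a hz h0.le
  have hz2 := N.update_nonneg a hz h2.le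
  have hne : (N.activeLinks (Function.update z a y₁)).Nonempty :=
    N.activeLinks_nonempty (a := a) (by rwa [Function.update_self])
  obtain ⟨l, hl, he⟩ := N.exists_scale_eq hz1 hne
  rw [he]
  have hl2 : l ∈ N.activeLinks (Function.update z a y₂) := by
    rwa [N.activeLinks_congr (N.update_pos_iff a h2 h0)]
  refine (N.scale_le hz2 hl2).trans ?_
  refine div_le_div_of_nonneg_left (N.c_pos l).le
    (N.load_add_offset_pos hz1 (N.mem_activeLinks.mp hl)) ?_
  rw [N.offset_congr (N.update_pos_iff a h2 h0)]
  have := N.load_update_mono (z := z) a l h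
  linarith

/-- The rate is a minimum over active links of `c y / (load + offset)`, each term strictly
increasing in `y`; positive demands share the same active links and offsets. It suffices to compare
on a link attaining the minimum at `y₂`. -/
theorem scale_update_mul_strictMono (hz : ∀ b, 0 ≤ z b) {y₁ y₂ : ℝ} (h0 : 0 < y₁) (h : y₁ < y₂) :
    N.scale (Function.update z a y₁) * y₁ < N.scale (Function.update z a y₂) * y₂ := by
  have h2 := h0.trans h
  have hz1 := N.update_nonneg a hz h0.le
  have hz2 := N.update_nonneg a hz h2.le
  have hne : (N.activeLinks (Function.update z a y₂)).Nonempty :=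
    N.activeLinks_nonempty (a := a) (by rwa [Function.update_self])
  obtain ⟨l, hl, he⟩ := N.exists_scale_eq hz2 hne
  have hl1 : l ∈ N.activeLinks (Function.update z a y₁) := by
    rwa [N.activeLinks_congr (N.update_pos_iff a h0 h2)]
  have hpos1 := N.load_add_offset_pos hz1 (N.mem_activeLinks.mp hl1)
  have hpos2 := N.load_add_offset_pos hz2 (N.mem_activeLinks.mp hl)
  have hoff : N.offset l (Function.update z a y₂) = N.offset l (Function.update z a y₁) :=
    N.offset_congr (N.update_pos_iff a h2 h0) l
  refine (mul_le_mul_of_nonneg_right (N.scale_le hz1 hl1) h0.le).trans_lt ?_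
  rw [he, div_mul_eq_mul_div, div_mul_eq_mul_div, div_lt_div_iff₀ hpos1 hpos2]
  have h3 := N.mul_load_update_le a hz l h0.le h.le
  have h4 := N.otherLoad_add_offset_pos a hz l h0.le
  rw [hoff]
  have h5 := mul_pos (sub_pos.mpr h) h4
  have h6 : y₁ * (N.load l (Function.update z a y₂) + N.offset l (Function.update z a y₁))
      < y₂ * (N.load l (Function.update z a y₁) + N.offset l (Function.update z a y₁)) := by
    linarith
  have := mul_lt_mul_of_pos_left h6 (N.c_pos l)
  linarith

/-- The scaling factor may jump when the demand becomes positive, since active links and offsets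
change there. A bound uniform over positive demands replaces continuity at zero. -/
theorem exists_scale_update_le (hz : ∀ b, 0 ≤ z b) :
    ∃ R > 0, ∀ y > 0, N.scale (Function.update z a y) ≤ R := by
  obtain ⟨l, hl⟩ := N.route_nonempty a
  have hpos := N.otherLoad_add_offset_pos a hz l zero_le_one
  refine ⟨N.c l / (N.otherLoad l a z + N.offset l (Function.update z a 1)),
    div_pos (N.c_pos l) hpos, fun y hy => ?_⟩
  have hzy := N.update_nonneg a hz hy.le
  have hact := N.mem_activeLinks_of_pos (z := Function.update z a y) (a := a)
    (by rwa [Function.update_self]) hl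
  refine (N.scale_le hzy hact).trans (div_le_div_of_nonneg_left (N.c_pos l).le hpos ?_)
  rw [N.offset_congr (N.update_pos_iff a hy one_pos)]
  have h1 := N.otherLoad_le_load l a hzy
  rw [N.otherLoad_update] at h1
  linarith

/-- By changing its demand, an agent can move its rate by an arbitrarily small amount upwards. -/
theorem exists_scale_update_mem_Ioc (hz : ∀ b, 0 ≤ z b) {t : ℝ} (ht : N.scale z * z a < t) :
    ∃ y ≥ 0, N.scale z * z a < N.scale (Function.update z a y) * y ∧
      N.scale (Function.update z a y) * y ≤ t := by
  have hx0 := mul_nonneg (N.scale_nonneg hz) (hz a)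
  rcases eq_or_lt_of_le (hz a) with h0 | h0
  · obtain ⟨R, hR, hle⟩ := N.exists_scale_update_le a hz
    rw [← h0, mul_zero] at ht ⊢
    have hy : 0 < t / R := div_pos ht hR
    refine ⟨t / R, hy.le, ?_, ?_⟩
    · refine mul_pos (N.scale_pos (N.update_nonneg a hz hy.le) ?_) hy
      exact N.activeLinks_nonempty (a := a) (by rwa [Function.update_self])
    · calc _ ≤ R * (t / R) := mul_le_mul_of_nonneg_right (hle _ hy) hy.le
        _ = t := by field_simp
  · have hs := N.scale_pos hz (N.activeLinks_nonempty h0)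
    have hy : z a < t / N.scale z := by rwa [lt_div_iff₀' hs]
    refine ⟨t / N.scale z, (h0.trans hy).le, ?_, ?_⟩
    -- No continuity of the rate is used: the demand `t / scale z` would give exactly `t` at the old
    -- factor, raising the demand lowers the factor, and strict monotonicity keeps the new rate
    -- above the old one.
    · simpa using N.scale_update_mul_strictMono a hz h0 hy
    · have h1 := N.scale_update_antitone a hz h0 hy.le
      rw [Function.update_eq_self] at h1
      calc _ ≤ N.scale z * (t / N.scale z) := mul_le_mul_of_nonneg_right h1 (h0.trans hy).le
        _ = t := by field_simp

/-- By changing its demand, an agent can move its rate by an arbitrarily small amount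
downwards. -/
theorem exists_scale_update_mem_Ico (hz : ∀ b, 0 ≤ z b) {t : ℝ} (ht0 : 0 ≤ t)
    (ht : t < N.scale z * z a) :
    ∃ y ≥ 0, t ≤ N.scale (Function.update z a y) * y ∧
      N.scale (Function.update z a y) * y < N.scale z * z a := by
  have h0 : 0 < z a := by
    rcases eq_or_lt_of_le (hz a) with h0 | h0
    · rw [← h0, mul_zero] at ht; linarith
    · exact h0
  have hs := N.scale_pos hz (N.activeLinks_nonempty h0)
  rcases eq_or_lt_of_le ht0 with rfl | ht0
  · exact ⟨0, le_rfl, by simp, by simpa using ht⟩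
  have hy : t / N.scale z < z a := by rwa [div_lt_iff₀' hs]
  have hy0 : 0 < t / N.scale z := div_pos ht0 hs
  refine ⟨t / N.scale z, hy0.le, ?_, ?_⟩
  · have h1 := N.scale_update_antitone a hz hy0 hy.le
    rw [Function.update_eq_self] at h1
    calc t = N.scale z * (t / N.scale z) := by field_simp
      _ ≤ _ := mul_le_mul_of_nonneg_right h1 hy0.le
  · simpa using N.scale_update_mul_strictMono a hz hy0 hy

end Scale

/-! ### Demands, agents, and the cyclic order within a group. -/

section Agents

variable {Λ : Type*} (N : MulticastNetwork Λ)

theorem demands_nonneg (s : N.Profile) (a : N.Agent) : 0 ≤ N.demands s a := (s a).demand.2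

theorem demands_update (s : N.Profile) (a : N.Agent) (b : N.Message a) :
    N.demands (Function.update s a b) = Function.update (N.demands s) a (b.demand : ℝ) := by
  funext c
  by_cases hc : c = a
  · subst hc; simp [demands]
  · simp [demands, hc]

theorem mk_ne_of_snd_ne {a : N.Agent} {i : Fin (N.G a.1)} (h : i ≠ a.2) :
    (⟨a.1, i⟩ : N.Agent) ≠ a := by
  rintro he
  apply h
  have := (Sigma.mk.inj_iff.mp (he : (⟨a.1, i⟩ : N.Agent) = ⟨a.1, a.2⟩)).2
  exact eq_of_heq this

end Agents

section Cyclic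

variable {Λ : Type*} [DecidableEq Λ] (N : MulticastNetwork Λ) {l : Λ} {k : Fin N.K}
  {i : Fin (N.G k)}

theorem memberAt_eq (hi : i ∈ N.members l k) (p : ℕ) :
    N.memberAt l k i p = (N.members l k).orderEmbOfFin rfl
      ⟨p % (N.members l k).card, Nat.mod_lt p (Finset.card_pos.mpr ⟨i, hi⟩)⟩ :=
  dif_pos (Finset.card_pos.mpr ⟨i, hi⟩)

theorem memberAt_mem (hi : i ∈ N.members l k) (p : ℕ) : N.memberAt l k i p ∈ N.members l k := by
  rw [N.memberAt_eq hi]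
  exact Finset.orderEmbOfFin_mem _ _ _

theorem position_orderEmbOfFin (p : Fin (N.members l k).card) :
    N.position l k ((N.members l k).orderEmbOfFin rfl p) = p := by
  have : (N.members l k).filter (fun j => j < (N.members l k).orderEmbOfFin rfl p)
      = (Finset.Iio p).map ((N.members l k).orderEmbOfFin rfl).toEmbedding := by
    ext j
    simp only [Finset.mem_filter, Finset.mem_map, Finset.mem_Iio, RelEmbedding.coe_toEmbedding]
    constructor
    · rintro ⟨hj, hlt⟩
      have hr : j ∈ Set.range ((N.members l k).orderEmbOfFin rfl) := by
        rw [Finset.range_orderEmbOfFin]; exact hj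
      obtain ⟨q, rfl⟩ := hr
      exact ⟨q, by simpa using hlt, rfl⟩
    · rintro ⟨q, hq, rfl⟩
      exact ⟨Finset.orderEmbOfFin_mem _ _ _, by simpa using hq⟩
  rw [position, this, Finset.card_map, Fin.card_Iio]

theorem position_memberAt (hi : i ∈ N.members l k) (p : ℕ) :
    N.position l k (N.memberAt l k i p) = p % (N.members l k).card := by
  rw [N.memberAt_eq hi, N.position_orderEmbOfFin]

theorem position_lt (hi : i ∈ N.members l k) : N.position l k i < (N.members l k).card := by
  refine Finset.card_lt_card (Finset.filter_ssubset.mpr ⟨i, hi, lt_irrefl i⟩)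

theorem orderEmbOfFin_position (hi : i ∈ N.members l k) :
    (N.members l k).orderEmbOfFin rfl ⟨N.position l k i, N.position_lt hi⟩ = i := by
  have hr : i ∈ Set.range ((N.members l k).orderEmbOfFin rfl) := by
    rw [Finset.range_orderEmbOfFin]; exact hi
  obtain ⟨q, hq⟩ := hr
  have h1 := N.position_orderEmbOfFin q
  rw [hq] at h1
  have : (⟨N.position l k i, N.position_lt hi⟩ : Fin (N.members l k).card) = q := Fin.ext h1
  rw [this, hq]

theorem next_mem (hi : i ∈ N.members l k) : N.next l k i ∈ N.members l k :=
  N.memberAt_mem hi _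

theorem prev_mem (hi : i ∈ N.members l k) : N.prev l k i ∈ N.members l k :=
  N.memberAt_mem hi _

/-- This identity links the two prices: an agent is charged the second price of its predecessor, and
the predecessor is penalised for deviating from this agent's first price. -/
theorem next_prev (hi : i ∈ N.members l k) : N.next l k (N.prev l k i) = i := by
  have hp := N.prev_mem hi
  have hlt := N.position_lt hi
  conv_rhs => rw [← N.orderEmbOfFin_position hi]
  rw [next, N.memberAt_eq hp]
  congr 2
  rw [prev, N.position_memberAt hi, Nat.mod_add_mod, Nat.sub_add_cancel (by omega),
    Nat.add_mod_right, Nat.mod_eq_of_lt hlt]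

theorem next_ne (hi : i ∈ N.members l k) (h : 2 ≤ (N.members l k).card) : N.next l k i ≠ i := by
  intro he
  have h1 := N.position_memberAt hi (N.position l k i + 1)
  change N.position l k (N.next l k i) = _ at h1
  rw [he] at h1
  have hlt := N.position_lt hi
  rcases Nat.lt_or_ge (N.position l k i + 1) (N.members l k).card with h2 | h2
  · rw [Nat.mod_eq_of_lt h2] at h1; omega
  · have h3 : N.position l k i + 1 = (N.members l k).card := by omega
    rw [h3, Nat.mod_self] at h1; omega

theorem prev_ne (hi : i ∈ N.members l k) (h : 2 ≤ (N.members l k).card) : N.prev l k i ≠ i := by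
  intro he
  have h1 := N.next_prev hi
  rw [he] at h1
  exact N.next_ne hi h h1

end Cyclic

/-! ### The tax and its change under a unilateral deviation. -/

section Taxes

variable {Λ : Type*} [DecidableEq Λ] (N : MulticastNetwork Λ)

theorem q₁_nonneg (s : N.Profile) (l : Λ) (a : N.Agent) : 0 ≤ N.q₁ s l a := by
  rw [q₁]; split_ifs
  · exact NNReal.coe_nonneg _
  · exact le_rfl

theorem q₂_nonneg (s : N.Profile) (l : Λ) (a : N.Agent) : 0 ≤ N.q₂ s l a := by
  rw [q₂]; split_ifs
  · exact NNReal.coe_nonneg _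
  · exact le_rfl

theorem groupPrice_nonneg (s : N.Profile) (l : Λ) (k : Fin N.K) : 0 ≤ N.groupPrice s l k :=
  Finset.sum_nonneg fun _ _ => N.q₁_nonneg s l _

theorem otherPrice_nonneg (s : N.Profile) (l : Λ) (k : Fin N.K) : 0 ≤ N.otherPrice s l k :=
  div_nonneg (Finset.sum_nonneg fun _ _ => N.groupPrice_nonneg s l _) (Nat.cast_nonneg _)

/-- The price at which agent `a` is charged for link `l`; it does not depend on the message of
`a`. -/
noncomputable def chargedPrice (s : N.Profile) (l : Λ) (a : N.Agent) : ℝ :=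
  if 2 ≤ (N.members l a.1).card then N.q₂ s l ⟨a.1, N.prev l a.1 a.2⟩
  else N.otherPrice s l a.1

/-- The penalty of agent `a` for a second price differing from the first price of the successor. -/
noncomputable def mismatch (s : N.Profile) (l : Λ) (a : N.Agent) : ℝ :=
  if 2 ≤ (N.members l a.1).card then
    (N.q₂ s l a - N.q₁ s l ⟨a.1, N.next l a.1 a.2⟩) ^ 2
  else 0

theorem chargedPrice_nonneg (s : N.Profile) (l : Λ) (a : N.Agent) : 0 ≤ N.chargedPrice s l a := by
  rw [chargedPrice]; split_ifs
  · exact N.q₂_nonneg _ _ _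
  · exact N.otherPrice_nonneg _ _ _

theorem mismatch_nonneg (s : N.Profile) (l : Λ) (a : N.Agent) : 0 ≤ N.mismatch s l a := by
  rw [mismatch]; split_ifs
  · exact sq_nonneg _
  · exact le_rfl

theorem q₁_eq_groupPrice_of_card_lt {s : N.Profile} {l : Λ} {a : N.Agent} (hl : l ∈ N.route a)
    (h : ¬ 2 ≤ (N.members l a.1).card) : N.q₁ s l a = N.groupPrice s l a.1 := by
  have ha : a.2 ∈ N.members l a.1 := N.mem_members.mpr hl
  have h1 : (N.members l a.1).card = 1 := by
    have := Finset.card_pos.mpr ⟨_, ha⟩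
    omega
  obtain ⟨j, hj⟩ := Finset.card_eq_one.mp h1
  have : a.2 = j := by simpa [hj] using ha
  rw [groupPrice, hj, Finset.sum_singleton, ← this]

/-- Each group price enters the averages of the other `K^l - 1` groups, each time with weight `1 /
(K^l - 1)`. -/
theorem sum_otherPrice {s : N.Profile} {l : Λ} (h : 2 ≤ (N.groupsOn l).card) :
    ∑ k ∈ N.groupsOn l, N.otherPrice s l k = ∑ k ∈ N.groupsOn l, N.groupPrice s l k := by
  have hc : (0 : ℝ) < ((N.groupsOn l).card : ℝ) - 1 := by
    have : (2 : ℝ) ≤ (N.groupsOn l).card := by exact_mod_cast h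
    linarith
  have h1 : ∀ k ∈ N.groupsOn l, N.otherPrice s l k
      = (∑ k' ∈ N.groupsOn l, N.groupPrice s l k' - N.groupPrice s l k)
        / ((N.groupsOn l).card - 1) := by
    intro k hk
    rw [otherPrice, Finset.card_erase_of_mem hk, Nat.cast_sub (by omega), Nat.cast_one,
      Finset.sum_erase_eq_sub hk]
  rw [Finset.sum_congr rfl h1, ← Finset.sum_div, Finset.sum_sub_distrib, Finset.sum_const,
    nsmul_eq_mul, div_eq_iff hc.ne']
  ring

theorem otherPrice_eq_of_forall_eq {s : N.Profile} {l : Λ} (h : 2 ≤ (N.groupsOn l).card) {w : ℝ}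
    (hw : ∀ k ∈ N.groupsOn l, N.groupPrice s l k = w) {k : Fin N.K} (hk : k ∈ N.groupsOn l) :
    N.otherPrice s l k = w := by
  have hc : (0 : ℝ) < ((N.groupsOn l).erase k).card := by
    rw [Finset.card_erase_of_mem hk]
    exact_mod_cast (by omega : 0 < (N.groupsOn l).card - 1)
  rw [otherPrice, Finset.sum_congr rfl fun k' hk' => hw k' (Finset.mem_of_mem_erase hk'),
    Finset.sum_const, nsmul_eq_mul]
  field_simp

/-! ### Unilateral deviations -/

variable (s : N.Profile) (a : N.Agent) (b : N.Message a)

theorem q₁_update_of_ne (l : Λ) {c : N.Agent} (hc : c ≠ a) :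
    N.q₁ (Function.update s a b) l c = N.q₁ s l c := by
  simp [q₁, hc]

theorem q₂_update_of_ne (l : Λ) {c : N.Agent} (hc : c ≠ a) :
    N.q₂ (Function.update s a b) l c = N.q₂ s l c := by
  simp [q₂, hc]

theorem q₁_update_self {l : Λ} (hl : l ∈ N.route a) :
    N.q₁ (Function.update s a b) l a = b.price₁ ⟨l, hl⟩ := by
  simp [q₁, hl]

theorem q₂_update_self {l : Λ} (hl : l ∈ N.route a) :
    N.q₂ (Function.update s a b) l a = b.price₂ ⟨l, hl⟩ := by
  simp [q₂, hl]

theorem otherPrice_update (l : Λ) :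
    N.otherPrice (Function.update s a b) l a.1 = N.otherPrice s l a.1 := by
  rw [otherPrice, otherPrice]
  congr 1
  refine Finset.sum_congr rfl fun k hk => Finset.sum_congr rfl fun i _ => ?_
  exact N.q₁_update_of_ne s a b l fun h => (Finset.mem_erase.mp hk).1 (by rw [← h])

theorem groupPrice_update {l : Λ} (hl : l ∈ N.route a) :
    N.groupPrice (Function.update s a b) l a.1
      = N.groupPrice s l a.1 + (b.price₁ ⟨l, hl⟩ - N.q₁ s l a) := by
  have ha : a.2 ∈ N.members l a.1 := N.mem_members.mpr hl
  rw [groupPrice, groupPrice, ← Finset.add_sum_erase _ _ ha, ← Finset.add_sum_erase _ _ ha]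
  have : ∀ i ∈ (N.members l a.1).erase a.2,
      N.q₁ (Function.update s a b) l ⟨a.1, i⟩ = N.q₁ s l ⟨a.1, i⟩ := fun i hi =>
    N.q₁_update_of_ne s a b l (N.mk_ne_of_snd_ne (Finset.mem_erase.mp hi).1)
  rw [Finset.sum_congr rfl this]
  have h1 : N.q₁ (Function.update s a b) l ⟨a.1, a.2⟩ = b.price₁ ⟨l, hl⟩ :=
    N.q₁_update_self s a b hl
  rw [h1]
  change _ + _ = N.q₁ s l a + _ + _
  ring

theorem chargedPrice_update {l : Λ} (hl : l ∈ N.route a) :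
    N.chargedPrice (Function.update s a b) l a = N.chargedPrice s l a := by
  rw [chargedPrice, chargedPrice]
  split_ifs with h
  · exact N.q₂_update_of_ne s a b l (N.mk_ne_of_snd_ne (N.prev_ne (N.mem_members.mpr hl) h))
  · exact N.otherPrice_update s a b l

theorem mismatch_update {l : Λ} (hl : l ∈ N.route a) :
    N.mismatch (Function.update s a b) l a =
      if 2 ≤ (N.members l a.1).card then
        (b.price₂ ⟨l, hl⟩ - N.q₁ s l ⟨a.1, N.next l a.1 a.2⟩) ^ 2
      else 0 := by
  rw [mismatch]
  split_ifs with h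
  · rw [N.q₂_update_self s a b hl,
      N.q₁_update_of_ne s a b l (N.mk_ne_of_snd_ne (N.next_ne (N.mem_members.mpr hl) h))]
  · rfl

variable [Fintype Λ] (η ξ : ℝ)

theorem linkTax_eq (l : Λ) :
    N.linkTax η ξ s l a.1 a.2 =
      N.alloc s a * N.α l a * N.chargedPrice s l a + N.mismatch s l a
      + (N.groupPrice s l a.1 - N.otherPrice s l a.1) ^ 2
      + η * N.chargedPrice s l a * (N.q₁ s l a - N.chargedPrice s l a)
          * (N.groupRate s l a.1 - N.α l a * N.alloc s a)
      + ξ * N.otherPrice s l a.1 * (N.groupPrice s l a.1 - N.otherPrice s l a.1)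
          * N.slack s l := by
  rw [linkTax, chargedPrice, mismatch]
  split_ifs with h
  · rfl
  · rw [add_zero]

/-- Isolates the deviator's own influence: apart from the rates, its second price enters only
through a square, and its first price through a quadratic with leading coefficient `1`. -/
theorem linkTax_update {l : Λ} (hl : l ∈ N.route a) :
    N.linkTax η ξ (Function.update s a b) l a.1 a.2 =
      N.alloc (Function.update s a b) a * N.α l a * N.chargedPrice s l a
      + (if 2 ≤ (N.members l a.1).card then
        ((b.price₂ ⟨l, hl⟩ : ℝ) - N.q₁ s l ⟨a.1, N.next l a.1 a.2⟩) ^ 2 else 0)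
      + (N.groupPrice s l a.1 - N.otherPrice s l a.1 + (b.price₁ ⟨l, hl⟩ - N.q₁ s l a)) ^ 2
      + η * N.chargedPrice s l a * (b.price₁ ⟨l, hl⟩ - N.chargedPrice s l a)
          * (N.groupRate (Function.update s a b) l a.1
            - N.α l a * N.alloc (Function.update s a b) a)
      + ξ * N.otherPrice s l a.1
          * (N.groupPrice s l a.1 - N.otherPrice s l a.1 + (b.price₁ ⟨l, hl⟩ - N.q₁ s l a))
          * N.slack (Function.update s a b) l := by
  rw [linkTax_eq, N.chargedPrice_update s a b hl, N.mismatch_update s a b hl,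
    N.groupPrice_update s a b hl, N.otherPrice_update, N.q₁_update_self s a b hl]
  ring

theorem slack_eq (l : Λ) :
    N.slack s l = N.c l - N.scale (N.demands s) * N.load l (N.demands s) := by
  rw [slack, load, Finset.mul_sum]; rfl

theorem slack_nonneg (l : Λ) : 0 ≤ N.slack s l := by
  rw [slack_eq, sub_nonneg]
  exact N.scale_mul_load_le (N.demands_nonneg s) l

theorem alloc_nonneg : 0 ≤ N.alloc s a :=
  mul_nonneg (N.scale_nonneg (N.demands_nonneg s)) (N.demands_nonneg s a)

theorem mul_alloc_le_groupRate {l : Λ} (hl : l ∈ N.route a) :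
    N.α l a * N.alloc s a ≤ N.groupRate s l a.1 := by
  have h := mul_le_mul_of_nonneg_left
    (N.le_groupMax (N.mem_members.mpr hl : a.2 ∈ N.members l a.1) (N.demands s))
    (N.scale_nonneg (N.demands_nonneg s))
  calc N.α l a * N.alloc s a = _ := by rw [alloc]; ring
    _ ≤ _ := h

theorem groupRate_le {l : Λ} (hl : l ∈ N.route a) : N.groupRate s l a.1 ≤ N.c l :=
  N.scale_mul_groupMax_le (N.demands_nonneg s) (N.mem_groupsOn_of_mem_route hl)

end Taxes

/-! ### The centralised problem and sufficiency of the KKT conditions. -/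

section Optimality

variable {Λ : Type*} [DecidableEq Λ] (N : MulticastNetwork Λ)

/-- The price per unit of rate that agent `a` pays when it is charged `μ l a` for the capacity of
link `l`. -/
def unitPrice (μ : Λ → N.Agent → ℝ) (a : N.Agent) : ℝ := ∑ l ∈ N.route a, N.α l a * μ l a

/-- The rates `x`, the link prices `w` and the individual prices `μ` satisfy the
Karush–Kuhn–Tucker conditions of the centralised problem. -/
structure IsKKT (v : N.Agent → ℝ → ℝ) (x : N.Agent → ℝ) (w : Λ → ℝ) (μ : Λ → N.Agent → ℝ) :
    Prop where
  feasible : N.FeasibleRates x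
  price_nonneg : ∀ l, 0 ≤ w l
  share_nonneg : ∀ l a, 0 ≤ μ l a
  sum_share : ∀ l, ∀ k ∈ N.groupsOn l, ∑ i ∈ N.members l k, μ l ⟨k, i⟩ = w l
  price_mul_slack : ∀ l, w l * (N.c l - N.load l x) = 0
  share_mul_gap : ∀ a, ∀ l ∈ N.route a, μ l a * (N.groupMax l a.1 x - N.α l a * x a) = 0
  le_of_nonneg : ∀ a t, 0 ≤ t → v a t - N.unitPrice μ a * t ≤ v a (x a) - N.unitPrice μ a * x a

theorem feasible_groupMax {x : N.Agent → ℝ} (h : N.FeasibleRates x) :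
    N.Feasible x fun l k => N.groupMax l k x :=
  ⟨h.1, h.2, fun _ _ _ _ hi => N.le_groupMax hi x⟩

theorem feasibleRates_of_feasible {x : N.Agent → ℝ} {m : Λ → Fin N.K → ℝ}
    (h : N.Feasible x m) : N.FeasibleRates x :=
  ⟨h.1, fun l => (Finset.sum_le_sum fun k hk => N.groupMax_le hk (h.2.2 l k hk)).trans (h.2.1 l)⟩

theorem isOptimalRates_of_isOptimal {v : N.Agent → ℝ → ℝ} {x : N.Agent → ℝ}
    {m : Λ → Fin N.K → ℝ} (h : N.IsOptimal v x m) : N.IsOptimalRates v x :=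
  ⟨N.feasibleRates_of_feasible h.1, fun x' hx' => h.2 x' _ (N.feasible_groupMax hx')⟩

theorem isOptimal_groupMax {v : N.Agent → ℝ → ℝ} {x : N.Agent → ℝ} (h : N.IsOptimalRates v x) :
    N.IsOptimal v x fun l k => N.groupMax l k x :=
  ⟨N.feasible_groupMax h.1, fun x' _ hx' => h.2 x' (N.feasibleRates_of_feasible hx')⟩

variable [Fintype Λ]

theorem sum_route_eq (F : Λ → N.Agent → ℝ) :
    ∑ a, ∑ l ∈ N.route a, F l a
      = ∑ l, ∑ k ∈ N.groupsOn l, ∑ i ∈ N.members l k, F l ⟨k, i⟩ := by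
  have h1 : ∀ a : N.Agent, ∑ l ∈ N.route a, F l a = ∑ l, if l ∈ N.route a then F l a else 0 :=
    fun a => by rw [Finset.sum_ite_mem, Finset.univ_inter]
  simp_rw [h1]
  rw [Finset.sum_comm]
  refine Finset.sum_congr rfl fun l _ => ?_
  rw [Fintype.sum_sigma]
  have h2 : ∀ k, ∑ i, (if l ∈ N.route ⟨k, i⟩ then F l ⟨k, i⟩ else 0)
      = ∑ i ∈ N.members l k, F l ⟨k, i⟩ := fun k => by rw [members, Finset.sum_filter]
  simp_rw [h2]
  symm
  refine Finset.sum_subset (Finset.subset_univ _) fun k _ hk => ?_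
  rw [mem_groupsOn, Finset.not_nonempty_iff_eq_empty] at hk
  rw [hk, Finset.sum_empty]

theorem sum_unitPrice_mul (μ : Λ → N.Agent → ℝ) (x : N.Agent → ℝ) :
    ∑ a, N.unitPrice μ a * x a
      = ∑ l, ∑ k ∈ N.groupsOn l, ∑ i ∈ N.members l k,
          μ l ⟨k, i⟩ * (N.α l ⟨k, i⟩ * x ⟨k, i⟩) := by
  rw [← N.sum_route_eq fun l a => μ l a * (N.α l a * x a)]
  refine Finset.sum_congr rfl fun a _ => ?_
  rw [unitPrice, Finset.sum_mul]
  exact Finset.sum_congr rfl fun l _ => by ring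

variable {N} {v : N.Agent → ℝ → ℝ} {x : N.Agent → ℝ} {w : Λ → ℝ} {μ : Λ → N.Agent → ℝ}

/-- Weak duality: at the prices `μ` every feasible allocation costs at most the value `∑ w c` of the
capacities, `x` costs exactly that by complementary slackness, and each agent's net benefit is
largest at `x`. The price condition is a global maximisation, so concavity plays no role here. -/
theorem IsKKT.isOptimalRates (h : N.IsKKT v x w μ) : N.IsOptimalRates v x := by
  refine ⟨h.feasible, fun x' hx' => ?_⟩
  have h1 : ∑ a, N.unitPrice μ a * x' a ≤ ∑ l, w l * N.c l := by
    rw [sum_unitPrice_mul]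
    refine Finset.sum_le_sum fun l _ => ?_
    refine le_trans ?_ (mul_le_mul_of_nonneg_left (hx'.2 l) (h.price_nonneg l))
    rw [Finset.mul_sum]
    refine Finset.sum_le_sum fun k hk => ?_
    rw [← h.sum_share l k hk, Finset.sum_mul]
    exact Finset.sum_le_sum fun i hi =>
      mul_le_mul_of_nonneg_left (N.le_groupMax hi x') (h.share_nonneg _ _)
  have h2 : ∑ a, N.unitPrice μ a * x a = ∑ l, w l * N.c l := by
    rw [sum_unitPrice_mul]
    refine Finset.sum_congr rfl fun l _ => ?_
    have h3 := h.price_mul_slack l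
    rw [mul_sub, sub_eq_zero] at h3
    rw [h3, load, Finset.mul_sum]
    refine Finset.sum_congr rfl fun k hk => ?_
    rw [← h.sum_share l k hk, Finset.sum_mul]
    refine Finset.sum_congr rfl fun i hi => ?_
    have h4 := h.share_mul_gap ⟨k, i⟩ l (N.mem_members.mp hi)
    rw [mul_sub, sub_eq_zero] at h4
    exact h4.symm
  have h3 : ∑ a, (v a (x' a) - N.unitPrice μ a * x' a)
      ≤ ∑ a, (v a (x a) - N.unitPrice μ a * x a) :=
    Finset.sum_le_sum fun a _ => h.le_of_nonneg a _ (hx'.1 a)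
  rw [Finset.sum_sub_distrib, Finset.sum_sub_distrib] at h3
  rw [welfare, welfare]
  linarith

end Optimality

/-! ### Every equilibrium satisfies the KKT conditions. -/

section Nash

variable {Λ : Type*} [DecidableEq Λ] {N : MulticastNetwork Λ}

/-- First-order condition, with complementarity, for minimising a quadratic of slope `G` at `q` over
the half-line of nonnegative prices. Small steps, `-G / 2` or `-min q (G / 2)`, let the linear term
win. -/
theorem nonneg_and_mul_eq_zero_of_forall {q G : ℝ} (hq : 0 ≤ q)
    (h : ∀ δ, -q ≤ δ → 0 ≤ δ * G + δ ^ 2) : 0 ≤ G ∧ q * G = 0 := by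
  have hG : 0 ≤ G := by
    by_contra! hG
    have := h (-G / 2) (by linarith)
    nlinarith
  refine ⟨hG, ?_⟩
  by_contra hne
  have hq' : 0 < q := lt_of_le_of_ne hq fun h => hne (by rw [← h, zero_mul])
  have hG' : 0 < G := lt_of_le_of_ne hG fun h => hne (by rw [← h, mul_zero])
  have hm : 0 < min q (G / 2) := lt_min hq' (by linarith)
  have h1 := h (-min q (G / 2)) (neg_le_neg (min_le_left _ _))
  have h2 : min q (G / 2) ≤ G / 2 := min_le_right _ _
  nlinarith

variable [Fintype Λ]

theorem alloc_congr {s s' : N.Profile} (h : N.demands s = N.demands s') :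
    N.alloc s = N.alloc s' := by
  funext a; rw [alloc, alloc, h]

theorem groupRate_congr {s s' : N.Profile} (h : N.demands s = N.demands s') :
    N.groupRate s = N.groupRate s' := by
  funext l k; rw [groupRate, groupRate, h]

theorem slack_congr {s s' : N.Profile} (h : N.demands s = N.demands s') :
    N.slack s = N.slack s' := by
  funext l; rw [slack, slack, groupRate_congr h]

variable {v : N.Agent → ℝ → ℝ} {η ξ : ℝ} {s : N.Profile}

/-- Deviating in the two prices for one link leaves demands, rates and all other link taxes
unchanged, so equilibrium forces each link tax to be minimal on its own. -/
theorem IsNash.linkTax_le (h : N.IsNash v η ξ s) {a : N.Agent} {l : Λ} (hl : l ∈ N.route a)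
    (p₁ p₂ : NNReal) :
    N.linkTax η ξ s l a.1 a.2 ≤
      N.alloc s a * N.α l a * N.chargedPrice s l a
      + (if 2 ≤ (N.members l a.1).card then
        ((p₂ : ℝ) - N.q₁ s l ⟨a.1, N.next l a.1 a.2⟩) ^ 2 else 0)
      + (N.groupPrice s l a.1 - N.otherPrice s l a.1 + (p₁ - N.q₁ s l a)) ^ 2
      + η * N.chargedPrice s l a * (p₁ - N.chargedPrice s l a)
          * (N.groupRate s l a.1 - N.α l a * N.alloc s a)
      + ξ * N.otherPrice s l a.1
          * (N.groupPrice s l a.1 - N.otherPrice s l a.1 + (p₁ - N.q₁ s l a))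
          * N.slack s l := by
  let b : N.Message a := ⟨(s a).demand, Function.update (s a).price₁ ⟨l, hl⟩ p₁,
    Function.update (s a).price₂ ⟨l, hl⟩ p₂⟩
  have hd : N.demands (Function.update s a b) = N.demands s := by
    rw [demands_update]
    exact Function.update_eq_self a (N.demands s)
  have h1 := h a b
  rw [utility, utility, alloc_congr hd] at h1
  have h2 : N.tax η ξ s a ≤ N.tax η ξ (Function.update s a b) a := by linarith
  rw [tax, tax, ← Finset.add_sum_erase _ _ hl, ← Finset.add_sum_erase _ _ hl] at h2
  have h3 : ∀ l' ∈ (N.route a).erase l,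
      N.linkTax η ξ (Function.update s a b) l' a.1 a.2 = N.linkTax η ξ s l' a.1 a.2 := by
    intro l' hl'
    obtain ⟨hne, hl'⟩ := Finset.mem_erase.mp hl'
    have e1 : b.price₁ ⟨l', hl'⟩ = (s a).price₁ ⟨l', hl'⟩ :=
      Function.update_of_ne (fun h => hne (Subtype.mk.inj h)) _ _
    have e2 : b.price₂ ⟨l', hl'⟩ = (s a).price₂ ⟨l', hl'⟩ :=
      Function.update_of_ne (fun h => hne (Subtype.mk.inj h)) _ _
    have e3 : N.q₁ s l' a = (s a).price₁ ⟨l', hl'⟩ := dif_pos hl'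
    have e4 : N.q₂ s l' a = (s a).price₂ ⟨l', hl'⟩ := dif_pos hl'
    rw [N.linkTax_update s a b η ξ hl', N.linkTax_eq, alloc_congr hd, groupRate_congr hd,
      slack_congr hd, e1, e2, ← e3, ← e4, sub_self, add_zero, mismatch]
  rw [Finset.sum_congr rfl h3, add_le_add_iff_right, N.linkTax_update s a b η ξ hl,
    alloc_congr hd, groupRate_congr hd, slack_congr hd] at h2
  simpa [b] using h2

theorem IsNash.mismatch_eq_zero (h : N.IsNash v η ξ s) {a : N.Agent} {l : Λ}
    (hl : l ∈ N.route a) : N.mismatch s l a = 0 := by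
  refine le_antisymm ?_ (N.mismatch_nonneg s l a)
  have h1 := h.linkTax_le hl (N.q₁ s l a).toNNReal
    (N.q₁ s l ⟨a.1, N.next l a.1 a.2⟩).toNNReal
  rw [linkTax_eq, Real.coe_toNNReal _ (N.q₁_nonneg s l a),
    Real.coe_toNNReal _ (N.q₁_nonneg s l ⟨a.1, N.next l a.1 a.2⟩)] at h1
  simp only [sub_self, add_zero, zero_pow two_ne_zero, ite_self] at h1
  linarith

theorem IsNash.first_order (h : N.IsNash v η ξ s) {a : N.Agent} {l : Λ} (hl : l ∈ N.route a) :
    let G := 2 * (N.groupPrice s l a.1 - N.otherPrice s l a.1)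
      + η * N.chargedPrice s l a * (N.groupRate s l a.1 - N.α l a * N.alloc s a)
      + ξ * N.otherPrice s l a.1 * N.slack s l
    0 ≤ G ∧ N.q₁ s l a * G = 0 := by
  refine nonneg_and_mul_eq_zero_of_forall (N.q₁_nonneg s l a) fun δ hδ => ?_
  have h1 := h.linkTax_le hl (N.q₁ s l a + δ).toNNReal (N.q₂ s l a).toNNReal
  rw [linkTax_eq, mismatch, Real.coe_toNNReal _ (by linarith : 0 ≤ N.q₁ s l a + δ),
    Real.coe_toNNReal _ (N.q₂_nonneg s l a)] at h1
  linarith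

theorem IsNash.chargedPrice_eq_of_card (h : N.IsNash v η ξ s) {a : N.Agent} {l : Λ}
    (hl : l ∈ N.route a) (hc : 2 ≤ (N.members l a.1).card) :
    N.chargedPrice s l a = N.q₁ s l a := by
  have ha : a.2 ∈ N.members l a.1 := N.mem_members.mpr hl
  have h1 := h.mismatch_eq_zero (a := ⟨a.1, N.prev l a.1 a.2⟩) (N.mem_members.mp (N.prev_mem ha))
  rw [mismatch, if_pos hc, N.next_prev ha] at h1
  rw [chargedPrice, if_pos hc]
  exact sub_eq_zero.mp (pow_eq_zero_iff two_ne_zero |>.mp h1)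

/-- The two families have equal sums, so a termwise inequality suffices. A group price above its
average makes the slope in `first_order` positive for every member; then all its first prices
vanish, and it cannot exceed a nonnegative average. -/
theorem IsNash.groupPrice_eq (h : N.IsNash v η ξ s) (hη : 0 < η) (hξ : 0 < ξ)
    {l : Λ} (hA : 2 ≤ (N.groupsOn l).card)
    {k : Fin N.K} (hk : k ∈ N.groupsOn l) : N.groupPrice s l k = N.otherPrice s l k := by
  refine (Finset.sum_eq_sum_iff_of_le ?_).mp (N.sum_otherPrice hA).symm k hk
  intro k hk
  by_contra! hlt
  have h0 : N.groupPrice s l k = 0 := by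
    refine Finset.sum_eq_zero fun i hi => ?_
    have hl := N.mem_members.mp hi
    have h1 := (h.first_order hl).2
    refine (mul_eq_zero.mp h1).resolve_right (ne_of_gt ?_)
    have h2 := mul_nonneg (mul_nonneg hη.le (N.chargedPrice_nonneg s l ⟨k, i⟩))
      (sub_nonneg.mpr (N.mul_alloc_le_groupRate s _ hl))
    have h3 := mul_nonneg (mul_nonneg hξ.le (N.otherPrice_nonneg s l k)) (N.slack_nonneg s l)
    change 0 < 2 * (N.groupPrice s l k - N.otherPrice s l k) + _ + _
    linarith
  linarith [N.otherPrice_nonneg s l k]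

theorem IsNash.chargedPrice_eq (h : N.IsNash v η ξ s) (hη : 0 < η) (hξ : 0 < ξ)
    (hA : ∀ l, 2 ≤ (N.groupsOn l).card)
    {a : N.Agent} {l : Λ} (hl : l ∈ N.route a) : N.chargedPrice s l a = N.q₁ s l a := by
  by_cases hc : 2 ≤ (N.members l a.1).card
  · exact h.chargedPrice_eq_of_card hl hc
  · rw [chargedPrice, if_neg hc, N.q₁_eq_groupPrice_of_card_lt hl hc,
      h.groupPrice_eq hη hξ (hA l) (N.mem_groupsOn_of_mem_route hl)]

/-- With the equilibrium prices kept, every penalty carries a vanishing price factor, whatever gap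
and slack the new demand creates. The agent therefore faces a fixed unit price. -/
theorem IsNash.tax_update_demand (h : N.IsNash v η ξ s) (hη : 0 < η) (hξ : 0 < ξ)
    (hA : ∀ l, 2 ≤ (N.groupsOn l).card)
    (a : N.Agent) (y : NNReal) :
    N.tax η ξ (Function.update s a ⟨y, (s a).price₁, (s a).price₂⟩) a
      = N.unitPrice (N.q₁ s) a
        * N.alloc (Function.update s a ⟨y, (s a).price₁, (s a).price₂⟩) a := by
  rw [tax, unitPrice, Finset.sum_mul]
  refine Finset.sum_congr rfl fun l hl => ?_
  have e3 : N.q₁ s l a = (s a).price₁ ⟨l, hl⟩ := dif_pos hl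
  have e4 : N.q₂ s l a = (s a).price₂ ⟨l, hl⟩ := dif_pos hl
  have hm := h.mismatch_eq_zero hl
  rw [mismatch, e4] at hm
  rw [N.linkTax_update s a _ η ξ hl]
  dsimp only
  rw [hm, ← e3, h.groupPrice_eq hη hξ (hA l) (N.mem_groupsOn_of_mem_route hl),
    h.chargedPrice_eq hη hξ hA hl]
  ring

theorem IsNash.tax_eq (h : N.IsNash v η ξ s) (hη : 0 < η) (hξ : 0 < ξ)
    (hA : ∀ l, 2 ≤ (N.groupsOn l).card)
    (a : N.Agent) : N.tax η ξ s a = N.unitPrice (N.q₁ s) a * N.alloc s a := by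
  have h1 := h.tax_update_demand hη hξ hA a (s a).demand
  have h2 : Function.update s a ⟨(s a).demand, (s a).price₁, (s a).price₂⟩ = s :=
    Function.update_eq_self a s
  rwa [h2] at h1

theorem IsNash.le_of_nonneg (h : N.IsNash v η ξ s) (hη : 0 < η) (hξ : 0 < ξ)
    (hA : ∀ l, 2 ≤ (N.groupsOn l).card)
    (hv : ∀ a, ConcaveOn ℝ (Set.Ici 0) (v a)) (a : N.Agent) {t : ℝ} (ht : 0 ≤ t) :
    v a t - N.unitPrice (N.q₁ s) a * t
      ≤ v a (N.alloc s a) - N.unitPrice (N.q₁ s) a * N.alloc s a := by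
  set P := N.unitPrice (N.q₁ s) a
  set x := N.alloc s a with hxdef
  have hx : 0 ≤ x := N.alloc_nonneg s a
  have hreach : ∀ y ≥ 0, v a (N.scale (Function.update (N.demands s) a y) * y)
      - P * (N.scale (Function.update (N.demands s) a y) * y) ≤ v a x - P * x := by
    intro y hy
    have h1 := h a ⟨y.toNNReal, (s a).price₁, (s a).price₂⟩
    rw [utility, utility, h.tax_update_demand hη hξ hA, h.tax_eq hη hξ hA, alloc,
      demands_update, Function.update_self, Real.coe_toNNReal _ hy] at h1
    exact h1
  by_contra! hlt
  -- The rate `t` itself may be out of reach. By concavity, an improvement at `t` is an improvement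
  -- everywhere strictly between `x` and `t`, and some such rate (or `t`) can be reached.
  have hconc : ∀ r, (x < r ∧ r ≤ t) ∨ (t ≤ r ∧ r < x) → v a x - P * x < v a r - P * r := by
    intro r hr
    have hd : t - x ≠ 0 := by
      rcases hr with hr | hr
      · exact (by linarith [hr.1, hr.2] : 0 < t - x).ne'
      · exact (by linarith [hr.1, hr.2] : t - x < 0).ne
    set θ := (r - x) / (t - x) with hθ
    have hθr : θ * (t - x) = r - x := div_mul_cancel₀ _ hd
    have hθ0 : 0 < θ := by
      rcases hr with hr | hr
      · exact div_pos (by linarith [hr.1]) (by linarith [hr.1, hr.2])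
      · exact div_pos_of_neg_of_neg (by linarith [hr.2]) (by linarith [hr.1, hr.2])
    have hθ1 : θ ≤ 1 := by
      rcases hr with hr | hr
      · exact (div_le_one (by linarith [hr.1, hr.2])).mpr (by linarith [hr.2])
      · exact (div_le_one_of_neg (by linarith [hr.1, hr.2])).mpr (by linarith [hr.1])
    have h1 := (hv a).2 (x := x) hx (y := t) ht (by linarith : 0 ≤ 1 - θ) hθ0.le (by ring)
    simp only [smul_eq_mul] at h1
    have hr' : (1 - θ) * x + θ * t = r := by linarith
    rw [hr'] at h1
    have h2 := mul_lt_mul_of_pos_left hlt hθ0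
    have h3 : P * r = (1 - θ) * (P * x) + θ * (P * t) := by rw [← hr']; ring
    linarith
  rcases lt_trichotomy t x with htx | htx | htx
  · obtain ⟨y, hy, h1, h2⟩ := N.exists_scale_update_mem_Ico a (N.demands_nonneg s) ht htx
    exact absurd (hreach y hy) (not_le.mpr (hconc _ (Or.inr ⟨h1, h2⟩)))
  · rw [htx] at hlt; exact lt_irrefl _ hlt
  · obtain ⟨y, hy, h1, h2⟩ := N.exists_scale_update_mem_Ioc a (N.demands_nonneg s) htx
    exact absurd (hreach y hy) (not_le.mpr (hconc _ (Or.inl ⟨h1, h2⟩)))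

theorem IsNash.exists_isKKT (h : N.IsNash v η ξ s) (hη : 0 < η) (hξ : 0 < ξ)
    (hA : ∀ l, 2 ≤ (N.groupsOn l).card)
    (hv : ∀ a, ConcaveOn ℝ (Set.Ici 0) (v a)) : ∃ w, N.IsKKT v (N.alloc s) w (N.q₁ s) := by
  have hw : ∀ l, ∃ w, ∀ k ∈ N.groupsOn l, N.groupPrice s l k = w := by
    intro l
    -- A group price equal to the mean of the other groups is the mean over all groups, hence
    -- independent of the group.
    refine ⟨(∑ k ∈ N.groupsOn l, N.groupPrice s l k) / (N.groupsOn l).card, fun k hk => ?_⟩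
    have h1 := h.groupPrice_eq hη hξ (hA l) hk
    have hc : (2 : ℝ) ≤ (N.groupsOn l).card := by exact_mod_cast hA l
    rw [otherPrice, Finset.card_erase_of_mem hk, Nat.cast_sub (by have := hA l; omega),
      Nat.cast_one, Finset.sum_erase_eq_sub hk, eq_div_iff (by linarith)] at h1
    rw [eq_div_iff (by linarith)]
    linarith
  choose w hw using hw
  have hother : ∀ l, ∀ k ∈ N.groupsOn l, N.otherPrice s l k = w l := fun l k hk => by
    rw [← h.groupPrice_eq hη hξ (hA l) hk, hw l k hk]
  have hne : ∀ l, ∃ k, k ∈ N.groupsOn l := fun l =>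
    Finset.card_pos.mp (by have := hA l; omega)
  have hw0 : ∀ l, 0 ≤ w l := fun l => by
    obtain ⟨k, hk⟩ := hne l
    rw [← hw l k hk]
    exact N.groupPrice_nonneg s l k
  -- With the price difference gone, the complementarity condition is a sum of two nonnegative terms
  -- equal to zero, so it splits into the two slackness conditions.
  have hfirst : ∀ a, ∀ l ∈ N.route a,
      N.q₁ s l a * (η * N.q₁ s l a * (N.groupRate s l a.1 - N.α l a * N.alloc s a)) = 0 ∧
      N.q₁ s l a * (ξ * w l * N.slack s l) = 0 := by
    intro a l hl
    have hk := N.mem_groupsOn_of_mem_route hl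
    have h1 := (h.first_order hl).2
    rw [h.groupPrice_eq hη hξ (hA l) hk, hother l _ hk, h.chargedPrice_eq hη hξ hA hl, sub_self,
      mul_zero, zero_add, mul_add] at h1
    have hq := N.q₁_nonneg s l a
    have h2 := mul_nonneg hq (mul_nonneg (mul_nonneg hη.le hq)
      (sub_nonneg.mpr (N.mul_alloc_le_groupRate s _ hl)))
    have h3 := mul_nonneg hq (mul_nonneg (mul_nonneg hξ.le (hw0 l)) (N.slack_nonneg s l))
    constructor <;> linarith
  have hload : ∀ l, N.load l (N.alloc s) = N.scale (N.demands s) * N.load l (N.demands s) :=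
    fun l => N.load_smul l (N.scale_nonneg (N.demands_nonneg s))
  have hgroup : ∀ l, ∀ k ∈ N.groupsOn l, N.groupMax l k (N.alloc s) = N.groupRate s l k :=
    fun l k hk => N.groupMax_smul hk (N.scale_nonneg (N.demands_nonneg s))
  refine ⟨w, N.feasibleRates_scale (N.demands_nonneg s), hw0, fun l a => N.q₁_nonneg s l a,
    hw, fun l => ?_, fun a l hl => ?_, fun a t ht => h.le_of_nonneg hη hξ hA hv a ht⟩
  · rw [hload, ← N.slack_eq]
    by_cases hwl : w l = 0
    · rw [hwl, zero_mul]
    · obtain ⟨k, hk⟩ := hne l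
      rw [← hw l k hk] at hwl
      obtain ⟨i, hi, hqi⟩ := Finset.exists_ne_zero_of_sum_ne_zero hwl
      have h1 := (mul_eq_zero.mp (hfirst ⟨k, i⟩ l (N.mem_members.mp hi)).2).resolve_left hqi
      rw [mul_assoc] at h1
      exact (mul_eq_zero.mp h1).resolve_left hξ.ne'
  · rw [hgroup l _ (N.mem_groupsOn_of_mem_route hl)]
    have h1 := (hfirst a l hl).1
    rcases mul_eq_zero.mp h1 with h2 | h2
    · rw [h2, zero_mul]
    · rw [mul_assoc] at h2
      exact (mul_eq_zero.mp h2).resolve_left hη.ne'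

end Nash

/-! ### Existence and uniqueness of the optimum, and its multipliers. -/

section Existence

variable {Λ : Type*} [DecidableEq Λ] (N : MulticastNetwork Λ)

theorem continuous_groupMax (l : Λ) (k : Fin N.K) : Continuous (N.groupMax l k) := by
  by_cases h : (N.members l k).Nonempty
  · have : N.groupMax l k
        = fun z => (N.members l k).sup' h fun i => N.α l ⟨k, i⟩ * z ⟨k, i⟩ := by
      funext z; rw [groupMax, dif_pos h]
    rw [this]
    exact Continuous.finset_sup'_apply h fun i _ => by fun_prop
  · have : N.groupMax l k = fun _ => 0 := by
      funext z; rw [groupMax, dif_neg h]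
    rw [this]
    exact continuous_const

variable {N} in
theorem FeasibleRates.mul_le {x : N.Agent → ℝ} (h : N.FeasibleRates x) {a : N.Agent} {l : Λ}
    (hl : l ∈ N.route a) : N.α l a * x a ≤ N.c l := by
  have h1 := N.le_groupMax (N.mem_members.mpr hl : a.2 ∈ N.members l a.1) x
  have h2 := Finset.single_le_sum (f := fun k => N.groupMax l k x)
    (fun k _ => N.groupMax_nonneg l k h.1) (N.mem_groupsOn_of_mem_route hl)
  exact h1.trans (h2.trans (h.2 l))

theorem isCompact_feasibleRates : IsCompact {x | N.FeasibleRates x} := by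
  choose f hf using N.route_nonempty
  have hclosed : IsClosed {x | N.FeasibleRates x} := by
    have : {x | N.FeasibleRates x} = (⋂ a, {x : N.Agent → ℝ | 0 ≤ x a})
        ∩ ⋂ l, {x | ∑ k ∈ N.groupsOn l, N.groupMax l k x ≤ N.c l} := by
      ext x; simp [FeasibleRates]
    rw [this]
    refine (isClosed_iInter fun a => isClosed_le continuous_const (continuous_apply a)).inter
      (isClosed_iInter fun l => isClosed_le ?_ continuous_const)
    exact continuous_finsetSum _ fun k _ => N.continuous_groupMax l k
  refine IsCompact.of_isClosed_subset
    (isCompact_univ_pi fun a => isCompact_Icc (a := (0 : ℝ)) (b := N.c (f a) / N.α (f a) a))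
    hclosed fun x hx a _ => ⟨hx.1 a, ?_⟩
  rw [le_div_iff₀' (N.α_pos a _ (hf a))]
  exact hx.mul_le (hf a)

theorem feasibleRates_zero : N.FeasibleRates 0 := by
  refine ⟨fun _ => le_rfl, fun l => ?_⟩
  refine (Finset.sum_nonpos fun k hk => N.groupMax_le hk fun i _ => ?_).trans (N.c_pos l).le
  simp

theorem exists_isOptimalRates {v : N.Agent → ℝ → ℝ}
    (hv : ∀ a, ContinuousOn (v a) (Set.Ici 0)) : ∃ x, N.IsOptimalRates v x := by
  obtain ⟨x, hx, hmax⟩ := N.isCompact_feasibleRates.exists_isMaxOn ⟨0, N.feasibleRates_zero⟩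
    (f := N.welfare v) (continuousOn_finsetSum _ fun a _ =>
      (hv a).comp (continuous_apply a).continuousOn fun x hx => hx.1 a)
  exact ⟨x, hx, fun x' hx' => hmax hx'⟩

variable {N} in
theorem IsOptimalRates.unique {v : N.Agent → ℝ → ℝ}
    (hv : ∀ a, StrictConcaveOn ℝ (Set.Ici 0) (v a)) {x x' : N.Agent → ℝ}
    (h : N.IsOptimalRates v x) (h' : N.IsOptimalRates v x') : x = x' := by
  by_contra hne
  obtain ⟨a, ha⟩ := Function.ne_iff.mp hne
  let m : N.Agent → ℝ := fun b => (1 / 2 : ℝ) * x b + (1 / 2 : ℝ) * x' b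
  have hm : N.FeasibleRates m := by
    refine ⟨fun b => ?_, fun l => ?_⟩
    · have := h.1.1 b
      have := h'.1.1 b
      positivity
    · have h1 : ∀ k ∈ N.groupsOn l,
          N.groupMax l k m ≤ 1 / 2 * N.groupMax l k x + 1 / 2 * N.groupMax l k x' := by
        intro k hk
        refine N.groupMax_le hk fun i hi => ?_
        have h2 := N.le_groupMax hi x
        have h3 := N.le_groupMax hi x'
        have : N.α l ⟨k, i⟩ * m ⟨k, i⟩
          = 1 / 2 * (N.α l ⟨k, i⟩ * x ⟨k, i⟩) + 1 / 2 * (N.α l ⟨k, i⟩ * x' ⟨k, i⟩) := by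
          simp only [m]; ring
        linarith
      have h2 := Finset.sum_le_sum h1
      rw [Finset.sum_add_distrib, ← Finset.mul_sum, ← Finset.mul_sum] at h2
      have h3 := h.1.2 l
      have h4 := h'.1.2 l
      linarith
  have hlt : ∑ b, (1 / 2 * v b (x b) + 1 / 2 * v b (x' b)) < ∑ b, v b (m b) := by
    refine Finset.sum_lt_sum (fun b _ => ?_) ⟨a, Finset.mem_univ _, ?_⟩
    · exact (hv b).concaveOn.2 (h.1.1 b) (h'.1.1 b) (by norm_num) (by norm_num) (by norm_num)
    · exact (hv a).2 (h.1.1 a) (h'.1.1 a) ha (by norm_num) (by norm_num) (by norm_num)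
  rw [Finset.sum_add_distrib, ← Finset.mul_sum, ← Finset.mul_sum] at hlt
  have h1 := h.2 m hm
  have h2 := h'.2 m hm
  rw [welfare, welfare] at h1 h2
  linarith

/-- A constraint function of the centralised problem: the capacity constraint of a link, or the
constraint coupling the rate of an agent to the rate of its group. -/
def constraint : Λ ⊕ Λ × N.Agent → (N.Agent → ℝ) × (Λ → Fin N.K → ℝ) → ℝ
  | .inl l, p => ∑ k ∈ N.groupsOn l, p.2 l k - N.c l
  | .inr (l, a), p => if l ∈ N.route a then N.α l a * p.1 a - p.2 l a.1 else -1

theorem convexOn_constraint (i : Λ ⊕ Λ × N.Agent)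
    {X : Set ((N.Agent → ℝ) × (Λ → Fin N.K → ℝ))} (hX : Convex ℝ X) :
    ConvexOn ℝ X (N.constraint i) := by
  refine ⟨hX, fun p _ q _ s t _ _ hst => ?_⟩
  rcases i with l | ⟨l, a⟩
  · simp only [constraint, Prod.snd_add, Prod.smul_snd, Pi.add_apply, Pi.smul_apply, smul_eq_mul,
      Finset.sum_add_distrib, ← Finset.mul_sum]
    have : N.c l = s * N.c l + t * N.c l := by rw [← add_mul, hst, one_mul]
    linarith
  · simp only [constraint, Prod.snd_add, Prod.smul_snd, Prod.fst_add, Prod.smul_fst,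
      Pi.add_apply, Pi.smul_apply, smul_eq_mul]
    split_ifs
    · linarith
    · linarith

-- Multipliers are taken for the formulation with auxiliary group rates, where all constraints are
-- affine. The group rates have no sign constraint, so the Lagrangian can only stay bounded if their
-- coefficients vanish; this yields `sum_share`.
variable {N} in
theorem IsOptimalRates.exists_isKKT [Fintype Λ] {v : N.Agent → ℝ → ℝ}
    (hv : ∀ a, ConcaveOn ℝ (Set.Ici 0) (v a)) {x : N.Agent → ℝ} (h : N.IsOptimalRates v x) :
    ∃ w μ, N.IsKKT v x w μ := by
  let X : Set ((N.Agent → ℝ) × (Λ → Fin N.K → ℝ)) := {p | ∀ a, 0 ≤ p.1 a}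
  have hX : Convex ℝ X := by
    intro p hp q hq s t hs ht _ a
    exact add_nonneg (mul_nonneg hs (hp a)) (mul_nonneg ht (hq a))
  have hf : ConcaveOn ℝ X fun p => N.welfare v p.1 := by
    refine ⟨hX, fun p hp q hq s t hs ht hst => ?_⟩
    simp only [welfare, smul_eq_mul]
    rw [Finset.mul_sum, Finset.mul_sum, ← Finset.sum_add_distrib]
    exact Finset.sum_le_sum fun a _ => (hv a).2 (hp a) (hq a) hs ht hst
  -- The `+ 1` leaves part of the capacity unused, so together with zero rates all constraints hold
  -- strictly; links off a route have the constant constraint `-1`.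
  let m₀ : Λ → Fin N.K → ℝ := fun l _ => N.c l / ((N.groupsOn l).card + 1)
  have hm₀ : ∀ l k, 0 < m₀ l k := fun l k => div_pos (N.c_pos l) (by positivity)
  have hslater : ∀ i, N.constraint i ((0 : N.Agent → ℝ), m₀) < 0 := by
    rintro (l | ⟨l, a⟩)
    · simp only [constraint, m₀, Finset.sum_const, nsmul_eq_mul]
      have hc := N.c_pos l
      have hn : (0 : ℝ) < (N.groupsOn l).card + 1 := by positivity
      rw [sub_neg, mul_div_assoc', div_lt_iff₀ hn]
      linarith
    · simp only [constraint, Pi.zero_apply, mul_zero, zero_sub]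
      split_ifs
      · linarith [hm₀ l a.1]
      · norm_num
  obtain ⟨lam, hlam, hdual⟩ := exists_lagrange_multipliers hf
    (fun i => N.convexOn_constraint i hX) (x₀ := ((0 : N.Agent → ℝ), m₀)) (fun _ => le_rfl)
    hslater (p := N.welfare v x) (by
      rintro ⟨x', m'⟩ hx' hcon
      refine h.2 x' (N.feasibleRates_of_feasible (m := m') ⟨hx', fun l => ?_, fun l k hk i hi => ?_⟩)
      · exact sub_nonpos.mp (hcon (.inl l))
      · have h1 := hcon (.inr (l, ⟨k, i⟩))
        simp only [constraint, N.mem_members.mp hi, if_true] at h1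
        linarith)
  set w : Λ → ℝ := fun l => lam (.inl l) with hw
  set μ : Λ → N.Agent → ℝ := fun l a => lam (.inr (l, a)) with hμ
  have hw0 : ∀ l, 0 ≤ w l := fun l => hlam _
  have hμ0 : ∀ l a, 0 ≤ μ l a := fun l a => hlam _
  have hgroup : ∀ m : Λ → Fin N.K → ℝ, ∑ a : N.Agent, ∑ l ∈ N.route a, μ l a * m l a.1
      = ∑ l, ∑ k ∈ N.groupsOn l, (∑ i ∈ N.members l k, μ l ⟨k, i⟩) * m l k := by
    intro m
    rw [N.sum_route_eq fun l a => μ l a * m l a.1]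
    simp_rw [Finset.sum_mul]
  have hdual' : ∀ x' : N.Agent → ℝ, (∀ a, 0 ≤ x' a) → ∀ m : Λ → Fin N.K → ℝ,
      N.welfare v x' - ∑ a, N.unitPrice μ a * x' a + ∑ l, w l * N.c l
        + ∑ l, ∑ k ∈ N.groupsOn l, (∑ i ∈ N.members l k, μ l ⟨k, i⟩ - w l) * m l k
        ≤ N.welfare v x := by
    intro x' hx' m
    refine le_trans ?_ (hdual (x', m) hx')
    rw [Fintype.sum_sum_type, Fintype.sum_prod_type]
    have e1 : ∑ l, lam (.inl l) * N.constraint (.inl l) (x', m)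
        = ∑ l, ∑ k ∈ N.groupsOn l, w l * m l k - ∑ l, w l * N.c l := by
      rw [← Finset.sum_sub_distrib]
      refine Finset.sum_congr rfl fun l _ => ?_
      simp only [constraint]
      rw [mul_sub, Finset.mul_sum]
    -- Only an inequality: the dummy constraints with value `-1` may carry positive multipliers, and
    -- dropping them goes in the right direction.
    have e2 : ∑ l, ∑ a, lam (.inr (l, a)) * N.constraint (.inr (l, a)) (x', m)
        ≤ ∑ a, N.unitPrice μ a * x' a - ∑ a : N.Agent, ∑ l ∈ N.route a, μ l a * m l a.1 := by
      rw [Finset.sum_comm, ← Finset.sum_sub_distrib]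
      refine Finset.sum_le_sum fun a _ => ?_
      rw [unitPrice, Finset.sum_mul, ← Finset.sum_sub_distrib]
      have h1 : ∑ l ∈ N.route a, (N.α l a * μ l a * x' a - μ l a * m l a.1)
          = ∑ l, if l ∈ N.route a then N.α l a * μ l a * x' a - μ l a * m l a.1 else 0 := by
        rw [Finset.sum_ite_mem, Finset.univ_inter]
      rw [h1]
      refine Finset.sum_le_sum fun l _ => ?_
      simp only [constraint]
      split_ifs
      · exact le_of_eq (by simp only [μ]; ring)
      · linarith [hlam (.inr (l, a))]
    rw [hgroup] at e2
    simp only [sub_mul, Finset.sum_sub_distrib]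
    linarith
  have hshare : ∀ l, ∀ k ∈ N.groupsOn l, ∑ i ∈ N.members l k, μ l ⟨k, i⟩ = w l := by
    intro l k hk
    have h1 : ∀ T : ℝ, N.welfare v 0 + ∑ l, w l * N.c l
        + T * (∑ i ∈ N.members l k, μ l ⟨k, i⟩ - w l) ≤ N.welfare v x := by
      intro T
      have h2 := hdual' 0 (fun _ => le_rfl)
        (fun l' k' => if l' = l then if k' = k then T else 0 else 0)
      have h3 : ∑ l', ∑ k' ∈ N.groupsOn l', (∑ i ∈ N.members l' k', μ l' ⟨k', i⟩ - w l')
          * (if l' = l then if k' = k then T else 0 else 0)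
          = T * (∑ i ∈ N.members l k, μ l ⟨k, i⟩ - w l) := by
        rw [Finset.sum_eq_single l (fun l' _ hl' => by simp [hl']) (by simp),
          Finset.sum_eq_single k (fun k' _ hk' => by simp [hk']) (fun hk' => absurd hk hk')]
        simp only [if_true]
        ring
      rw [h3] at h2
      simpa using h2
    by_contra hne
    have hne' := sub_ne_zero.mpr hne
    have h2 := h1 ((N.welfare v x - (N.welfare v 0 + ∑ l, w l * N.c l) + 1)
      / (∑ i ∈ N.members l k, μ l ⟨k, i⟩ - w l))
    rw [div_mul_cancel₀ _ hne'] at h2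
    linarith
  have hlagr : ∀ x' : N.Agent → ℝ, (∀ a, 0 ≤ x' a) →
      N.welfare v x' - ∑ a, N.unitPrice μ a * x' a + ∑ l, w l * N.c l ≤ N.welfare v x := by
    intro x' hx'
    simpa using hdual' x' hx' 0
  have hslack0 : ∀ l, 0 ≤ w l * (N.c l - N.load l x) := fun l =>
    mul_nonneg (hw0 l) (sub_nonneg.mpr (h.1.2 l))
  have hgap0 : ∀ a, ∀ l ∈ N.route a, 0 ≤ μ l a * (N.groupMax l a.1 x - N.α l a * x a) :=
    fun a l hl => mul_nonneg (hμ0 l a) (sub_nonneg.mpr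
      (N.le_groupMax (N.mem_members.mpr hl : a.2 ∈ N.members l a.1) x))
  have hS1 : ∑ l, w l * (N.c l - N.load l x) = ∑ l, w l * N.c l - ∑ l, w l * N.load l x := by
    rw [← Finset.sum_sub_distrib]
    exact Finset.sum_congr rfl fun l _ => by ring
  have hS2 : ∑ a, ∑ l ∈ N.route a, μ l a * (N.groupMax l a.1 x - N.α l a * x a)
      = ∑ l, w l * N.load l x - ∑ a, N.unitPrice μ a * x a := by
    have h1 : ∑ l, w l * N.load l x
        = ∑ a : N.Agent, ∑ l ∈ N.route a, μ l a * N.groupMax l a.1 x := by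
      rw [hgroup fun l k => N.groupMax l k x]
      refine Finset.sum_congr rfl fun l _ => ?_
      rw [load, Finset.mul_sum]
      exact Finset.sum_congr rfl fun k hk => by rw [hshare l k hk]
    rw [h1, ← Finset.sum_sub_distrib]
    refine Finset.sum_congr rfl fun a _ => ?_
    rw [unitPrice, Finset.sum_mul, ← Finset.sum_sub_distrib]
    exact Finset.sum_congr rfl fun l _ => by ring
  have hS1' := Finset.sum_nonneg fun l (_ : l ∈ Finset.univ) => hslack0 l
  have hS2' := Finset.sum_nonneg fun a (_ : a ∈ Finset.univ) => Finset.sum_nonneg (hgap0 a)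
  -- At the optimum itself the dual bound says that total priced slack plus total priced gap is at
  -- most zero. All terms are nonnegative, so each of them vanishes.
  have hself := hlagr x h.1.1
  refine ⟨w, μ, h.1, hw0, hμ0, hshare, fun l => ?_, fun a l hl => ?_, fun a t ht => ?_⟩
  · exact (Finset.sum_eq_zero_iff_of_nonneg fun l _ => hslack0 l).mp (by linarith) l
      (Finset.mem_univ l)
  · have h1 := (Finset.sum_eq_zero_iff_of_nonneg fun a _ => Finset.sum_nonneg (hgap0 a)).mp
      (by linarith) a (Finset.mem_univ a)
    exact (Finset.sum_eq_zero_iff_of_nonneg (hgap0 a)).mp h1 l hl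
  · have h1 := hlagr (Function.update x a t) (N.update_nonneg a h.1.1 ht)
    have h2 : ∑ b, (v b (Function.update x a t b) - N.unitPrice μ b * Function.update x a t b)
        ≤ ∑ b, (v b (x b) - N.unitPrice μ b * x b) := by
      rw [Finset.sum_sub_distrib, Finset.sum_sub_distrib]
      simp only [welfare] at h1
      linarith
    rw [← Finset.add_sum_erase _ _ (Finset.mem_univ a),
      ← Finset.add_sum_erase _ _ (Finset.mem_univ a), Function.update_self] at h2
    have h3 : ∀ b ∈ Finset.univ.erase a,
        v b (Function.update x a t b) - N.unitPrice μ b * Function.update x a t b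
          = v b (x b) - N.unitPrice μ b * x b := fun b hb => by
      rw [Function.update_of_ne (Finset.mem_erase.mp hb).1]
    rw [Finset.sum_congr rfl h3] at h2
    linarith

end Existence

/-! ### How slack and gap react to a change of one demand. -/

section Deviations

variable {Λ : Type*} [DecidableEq Λ] [Fintype Λ] {N : MulticastNetwork Λ}

/-- Feasibility makes the factor at least `1`; a larger factor would yield a feasible allocation
with strictly greater welfare. -/
theorem IsOptimalRates.scale_eq_one {v : N.Agent → ℝ → ℝ}
    (hv : ∀ a, StrictMonoOn (v a) (Set.Ici 0)) {x : N.Agent → ℝ} (h : N.IsOptimalRates v x)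
    (hS : ∀ l, 2 ≤ (N.support l x).card) [Nonempty Λ] : N.scale x = 1 := by
  have hne : ∀ l, (N.support l x).Nonempty := fun l =>
    Finset.card_pos.mp (by have := hS l; omega)
  obtain ⟨l₀⟩ := ‹Nonempty Λ›
  have hact : (N.activeLinks x).Nonempty := ⟨l₀, N.mem_activeLinks.mpr (hne l₀)⟩
  obtain ⟨l, hl, he⟩ := N.exists_scale_eq h.1.1 hact
  have h1 : 1 ≤ N.scale x := by
    rw [he, offset, if_pos (hS l), add_zero, one_le_div (N.load_pos h.1.1 (hne l))]
    exact h.1.2 l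
  refine le_antisymm ?_ h1
  by_contra! hlt
  obtain ⟨k, hk⟩ := hne l₀
  obtain ⟨-, i, -, hi⟩ := N.mem_support.mp hk
  have h2 := h.2 _ (N.feasibleRates_scale h.1.1)
  refine absurd h2 (not_le.mpr ?_)
  have hnn : ∀ a, 0 ≤ N.scale x * x a := fun a => mul_nonneg (by linarith) (h.1.1 a)
  refine Finset.sum_lt_sum (fun a _ => ?_) ⟨⟨k, i⟩, Finset.mem_univ _, ?_⟩
  · exact (hv a).monotoneOn (h.1.1 a) (hnn a) (le_mul_of_one_le_left (h.1.1 a) h1)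
  · exact hv _ (h.1.1 _) (hnn _) (lt_mul_of_one_lt_left hi hlt)

/-- A feasible demand vector that is not scaled by the mechanism, with at least two groups having
positive demand on each link. -/
structure IsUnscaled (N : MulticastNetwork Λ) (z : N.Agent → ℝ) : Prop where
  nonneg : ∀ a, 0 ≤ z a
  load_le : ∀ l, N.load l z ≤ N.c l
  two_le : ∀ l, 2 ≤ (N.support l z).card
  scale_eq : N.scale z = 1

variable {z : N.Agent → ℝ} (hz : N.IsUnscaled z) (a : N.Agent)
include hz

/-- For an upward deviation, on the link attaining the minimum, both sides compare with `y - z a`: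
the load, hence the drop of the factor, grows at most by a multiple of it, while `otherLoad` makes
the rate grow at least by a multiple of it. The sum over links serves as a bound for whichever link
is the bottleneck. -/
theorem IsUnscaled.exists_one_sub_scale_le :
    ∃ C, 0 ≤ C ∧ ∀ y, 0 < y → z a ≤ y → 1 - N.scale (Function.update z a y)
      ≤ C * |N.scale (Function.update z a y) * y - z a| := by
  choose A hA0 hA using fun l => N.exists_load_update_le (z := z) a l
  have hO : ∀ l, 0 < N.otherLoad l a z := fun l => N.otherLoad_pos hz.nonneg a (hz.two_le l)
  have hC0 : ∀ l, 0 ≤ A l / N.otherLoad l a z := fun l => div_nonneg (hA0 l) (hO l).le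
  refine ⟨∑ l, A l / N.otherLoad l a z, Finset.sum_nonneg fun l _ => hC0 l, fun y hy hzy => ?_⟩
  have hu := N.update_nonneg a hz.nonneg hy.le
  obtain ⟨l, hl, he⟩ := N.exists_scale_eq hu
    (N.activeLinks_nonempty (a := a) (by rwa [Function.update_self]))
  have hsupp : N.support l z ⊆ N.support l (Function.update z a y) := by
    refine N.support_mono (fun b hb => ?_) l
    by_cases hba : b = a
    · rw [hba, Function.update_self]; exact hy
    · rwa [Function.update_of_ne hba]
  rw [offset, if_pos ((hz.two_le l).trans (Finset.card_le_card hsupp)), add_zero] at he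
  have hL := N.load_pos hu (N.mem_activeLinks.mp hl)
  have h1 := hA l (z a) y hzy
  have h2 := N.mul_load_update_le a hz.nonneg l (hz.nonneg a) hzy
  rw [Function.update_eq_self] at h1 h2
  have hload := hz.load_le l
  set s := N.scale (Function.update z a y)
  set D := N.load l (Function.update z a y)
  have hsD : s * D = N.c l := by rw [he, div_mul_cancel₀ _ hL.ne']
  have h3 : (1 - s) * D ≤ A l * (y - z a) := by linarith
  have h4 : N.otherLoad l a z * (y - z a) ≤ (s * y - z a) * D := by
    have := mul_le_mul_of_nonneg_left hload hy.le
    have : (s * y - z a) * D = N.c l * y - z a * D := by rw [← hsD]; ring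
    linarith
  have h5 : (1 - s) * D ≤ A l / N.otherLoad l a z * (s * y - z a) * D := by
    refine h3.trans ?_
    have h6 := mul_le_mul_of_nonneg_left h4 (hC0 l)
    have h7 : A l / N.otherLoad l a z * (N.otherLoad l a z * (y - z a)) = A l * (y - z a) := by
      rw [← mul_assoc, div_mul_cancel₀ _ (hO l).ne']
    linarith
  calc 1 - s ≤ A l / N.otherLoad l a z * (s * y - z a) := le_of_mul_le_mul_right h5 hL
    _ ≤ A l / N.otherLoad l a z * |s * y - z a| :=
      mul_le_mul_of_nonneg_left (le_abs_self _) (hC0 l)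
    _ ≤ _ := mul_le_mul_of_nonneg_right
      (Finset.single_le_sum (f := fun l => A l / N.otherLoad l a z) (fun l _ => hC0 l)
        (Finset.mem_univ l)) (abs_nonneg _)

/-- Lowering the demand may raise the factor and so partly undo itself. On a saturated link the load
of the other groups limits this, both bounding the factor and forcing the rate to fall in proportion
to the demand. The case `y = 0` is included, as the offset only lowers the factor. -/
theorem IsUnscaled.exists_sub_le {l : Λ} (hl : N.load l z = N.c l) :
    ∃ R, 0 ≤ R ∧ ∃ C, 0 ≤ C ∧ ∀ y, 0 ≤ y → y ≤ z a → N.scale (Function.update z a y) ≤ R ∧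
      z a - y ≤ C * |N.scale (Function.update z a y) * y - z a| := by
  have hO := N.otherLoad_pos hz.nonneg a (hz.two_le l)
  have hc := (N.c_pos l).le
  refine ⟨N.c l / N.otherLoad l a z, div_nonneg hc hO.le, N.c l / N.otherLoad l a z,
    div_nonneg hc hO.le, fun y hy hyz => ?_⟩
  have hu := N.update_nonneg a hz.nonneg hy
  have hOD := N.otherLoad_le_load l a hu
  rw [N.otherLoad_update] at hOD
  have hact : l ∈ N.activeLinks (Function.update z a y) := by
    rw [mem_activeLinks]
    by_contra hne
    have := N.load_eq_zero hu hne
    linarith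
  have hs := N.scale_le hu hact
  have hoff := N.offset_nonneg l (Function.update z a y)
  have h1 := N.mul_load_update_le a hz.nonneg l hy hyz
  have hmono := N.load_update_mono (z := z) a l hyz
  rw [Function.update_eq_self, hl] at h1 hmono
  have hs0 := N.scale_nonneg hu
  set s := N.scale (Function.update z a y)
  set D := N.load l (Function.update z a y)
  have hD : 0 < D := hO.trans_le hOD
  have hs' : s ≤ N.c l / D :=
    hs.trans (div_le_div_of_nonneg_left hc hD (by linarith))
  refine ⟨hs'.trans (div_le_div_of_nonneg_left hc hO hOD), ?_⟩
  rw [le_div_iff₀ hD] at hs'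
  have h2 := mul_le_mul_of_nonneg_right hs' hy
  have h3 : (z a - y) * N.otherLoad l a z ≤ D * (z a - s * y) := by linarith
  have h4 : D * (z a - s * y) ≤ N.c l * |s * y - z a| := by
    rw [abs_sub_comm]
    exact mul_le_mul hmono (le_abs_self _) (by
      have := mul_nonneg (sub_nonneg.mpr hyz) hO.le
      exact nonneg_of_mul_nonneg_right (this.trans h3) hD) hc
  rw [div_mul_eq_mul_div, le_div_iff₀ hO]
  exact h3.trans h4

theorem IsUnscaled.exists_load_eq [Nonempty Λ] : ∃ l, N.load l z = N.c l := by
  have hne : ∀ l, (N.support l z).Nonempty := fun l =>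
    Finset.card_pos.mp (by have := hz.two_le l; omega)
  obtain ⟨l, hl, he⟩ := N.exists_scale_eq hz.nonneg
    ⟨Classical.arbitrary Λ, N.mem_activeLinks.mpr (hne _)⟩
  refine ⟨l, ?_⟩
  rw [hz.scale_eq, offset, if_pos (hz.two_le l), add_zero,
    eq_div_iff (N.load_pos hz.nonneg (hne l)).ne', one_mul] at he
  exact he

/-- When a single agent changes its demand, the capacity left unused on a saturated link is
controlled by the change of the rate of that agent. -/
theorem IsUnscaled.exists_slack_le {l : Λ} (hl : N.load l z = N.c l) :
    ∃ C, 0 ≤ C ∧ ∀ y, 0 ≤ y →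
      N.c l - N.scale (Function.update z a y) * N.load l (Function.update z a y)
        ≤ C * |N.scale (Function.update z a y) * y - z a| := by
  obtain ⟨C₁, hC₁, h₁⟩ := hz.exists_one_sub_scale_le a
  obtain ⟨R, -, C₂, hC₂, h₂⟩ := hz.exists_sub_le a hl
  obtain ⟨A, hA, hlip⟩ := N.exists_load_update_le (z := z) a l
  have hc := (N.c_pos l).le
  have hza := hz.nonneg a
  have hc3 : 0 ≤ N.c l / z a := div_nonneg hc hza
  -- One summand per case: `y ≥ z a`, `0 < y ≤ z a`, and withdrawal `y = 0`. The last is separate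
  -- because the factor can jump at zero: the slack is at most `c` while the rate changes by `z a`.
  -- If `z a = 0`, withdrawal changes nothing.
  refine ⟨N.c l * C₁ + A * C₂ + N.c l / z a, by positivity, fun y hy => ?_⟩
  have hu := N.update_nonneg a hz.nonneg hy
  have hd := abs_nonneg (N.scale (Function.update z a y) * y - z a)
  rcases eq_or_lt_of_le hy with rfl | hy
  · have hpos := mul_nonneg (N.scale_nonneg hu) (N.load_nonneg l hu)
    rcases eq_or_lt_of_le hza with h0 | h0
    · have : Function.update z a 0 = z := by rw [h0]; exact Function.update_eq_self a z
      rw [this, hz.scale_eq, hl, one_mul, sub_self]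
      positivity
    · rw [mul_zero, zero_sub, abs_neg, abs_of_pos h0, add_mul, div_mul_cancel₀ _ h0.ne']
      have : 0 ≤ (N.c l * C₁ + A * C₂) * z a := by positivity
      linarith
  rcases le_total (z a) y with hzy | hzy
  · have h3 := h₁ y hy hzy
    have hmono := N.load_update_mono (z := z) a l hzy
    rw [Function.update_eq_self, hl] at hmono
    have h4 := mul_le_mul_of_nonneg_left hmono (N.scale_nonneg hu)
    have h5 := mul_le_mul_of_nonneg_left h3 hc
    have h6 := mul_nonneg (add_nonneg (mul_nonneg hA hC₂) hc3) hd
    linarith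
  · have h3 := (h₂ y hy.le hzy).2
    have h4 := N.scale_update_antitone a hz.nonneg hy hzy
    have h5 := hlip y (z a) hzy
    rw [Function.update_eq_self] at h4 h5
    rw [hz.scale_eq] at h4
    have h6 := mul_le_mul_of_nonneg_right h4 (N.load_nonneg l hu)
    have h7 := mul_le_mul_of_nonneg_left h3 hA
    have h8 := mul_nonneg (add_nonneg (mul_nonneg hc hC₁) hc3) hd
    rw [hl] at h5
    linarith

/-- When a single agent determining the rate of its group changes its demand, the difference
between the rates of the group and the agent is controlled by the change of the rate of the
agent. -/
theorem IsUnscaled.exists_gap_le {l : Λ} (hl : l ∈ N.route a)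
    (ha : N.groupMax l a.1 z = N.α l a * z a) :
    ∃ C, 0 ≤ C ∧ ∀ y, 0 ≤ y →
      N.scale (Function.update z a y) * N.groupMax l a.1 (Function.update z a y)
        - N.α l a * (N.scale (Function.update z a y) * y)
        ≤ C * |N.scale (Function.update z a y) * y - z a| := by
  have : Nonempty Λ := ⟨l⟩
  obtain ⟨l₀, hl₀⟩ := hz.exists_load_eq
  obtain ⟨R, hR, C, hC, h⟩ := hz.exists_sub_le a hl₀
  have hα := (N.α_pos a l hl).le
  have hk := N.mem_groupsOn_of_mem_route hl
  refine ⟨R * N.α l a * C, by positivity, fun y hy => ?_⟩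
  have hs := N.scale_nonneg (N.update_nonneg a hz.nonneg hy)
  have hd := abs_nonneg (N.scale (Function.update z a y) * y - z a)
  rcases le_total (z a) y with hzy | hzy
  · have h1 := N.groupMax_update_le (z := z) a hk hl hzy
    rw [Function.update_eq_self, ha] at h1
    have h2 := mul_le_mul_of_nonneg_left h1 hs
    have : 0 ≤ R * N.α l a * C * |N.scale (Function.update z a y) * y - z a| := by positivity
    -- Upwards the agent still determines its group's rate, so the gap is at most zero.
    linarith
  · obtain ⟨h1, h2⟩ := h y hy hzy
    have h3 : N.groupMax l a.1 (Function.update z a y) ≤ N.α l a * z a := by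
      rw [← ha]
      refine N.groupMax_mono hk fun i _ => ?_
      exact (update_le_self_iff.mpr hzy) _
    have h4 := mul_le_mul_of_nonneg_left h3 hs
    have h5 := mul_le_mul_of_nonneg_right h1 (mul_nonneg hα (sub_nonneg.mpr hzy))
    have h6 := mul_le_mul_of_nonneg_left h2 (mul_nonneg hR hα)
    linarith

end Deviations

/-! ### The candidate profile and its stability for small tax constants. -/

section Equilibrium

variable {Λ : Type*} [DecidableEq Λ] (N : MulticastNetwork Λ)

/-- The profile announcing the rates `x` and the individual prices `μ`. -/
noncomputable def profileOf (x : N.Agent → ℝ) (μ : Λ → N.Agent → ℝ) : N.Profile := fun a =>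
  { demand := (x a).toNNReal
    price₁ := fun l => (μ l a).toNNReal
    price₂ := fun l => (μ l ⟨a.1, N.next l a.1 a.2⟩).toNNReal }

variable {N} {x : N.Agent → ℝ} {μ : Λ → N.Agent → ℝ}

theorem demands_profileOf (hx : ∀ a, 0 ≤ x a) : N.demands (N.profileOf x μ) = x := by
  funext a
  exact Real.coe_toNNReal _ (hx a)

theorem q₁_profileOf (hμ : ∀ l a, 0 ≤ μ l a) {l : Λ} {a : N.Agent} (hl : l ∈ N.route a) :
    N.q₁ (N.profileOf x μ) l a = μ l a := by
  rw [q₁, dif_pos hl]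
  exact Real.coe_toNNReal _ (hμ l a)

theorem q₂_profileOf (hμ : ∀ l a, 0 ≤ μ l a) {l : Λ} {a : N.Agent} (hl : l ∈ N.route a) :
    N.q₂ (N.profileOf x μ) l a = μ l ⟨a.1, N.next l a.1 a.2⟩ := by
  rw [q₂, dif_pos hl]
  exact Real.coe_toNNReal _ (hμ l _)

theorem groupPrice_profileOf (hμ : ∀ l a, 0 ≤ μ l a) (l : Λ) (k : Fin N.K) :
    N.groupPrice (N.profileOf x μ) l k = ∑ i ∈ N.members l k, μ l ⟨k, i⟩ :=
  Finset.sum_congr rfl fun _ hi => q₁_profileOf hμ (N.mem_members.mp hi)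

theorem mismatch_profileOf (hμ : ∀ l a, 0 ≤ μ l a) {l : Λ} {a : N.Agent} (hl : l ∈ N.route a) :
    N.mismatch (N.profileOf x μ) l a = 0 := by
  rw [mismatch, q₂_profileOf hμ hl, q₁_profileOf hμ
    (N.mem_members.mp (N.next_mem (N.mem_members.mpr hl))), sub_self, zero_pow two_ne_zero,
    ite_self]

variable {v : N.Agent → ℝ → ℝ} {w : Λ → ℝ}

namespace IsKKT

variable (h : N.IsKKT v x w μ) (hA : ∀ l, 2 ≤ (N.groupsOn l).card)
include h hA

theorem otherPrice_profileOf {l : Λ} {k : Fin N.K} (hk : k ∈ N.groupsOn l) :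
    N.otherPrice (N.profileOf x μ) l k = w l :=
  N.otherPrice_eq_of_forall_eq (hA l)
    (fun k hk => by rw [groupPrice_profileOf h.share_nonneg, h.sum_share l k hk]) hk

theorem chargedPrice_profileOf {l : Λ} {a : N.Agent} (hl : l ∈ N.route a) :
    N.chargedPrice (N.profileOf x μ) l a = μ l a := by
  have ha : a.2 ∈ N.members l a.1 := N.mem_members.mpr hl
  rw [chargedPrice]
  split_ifs with hc
  · rw [q₂_profileOf h.share_nonneg (N.mem_members.mp (N.prev_mem ha)), N.next_prev ha]
  · have hk := N.mem_groupsOn_of_mem_route hl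
    rw [h.otherPrice_profileOf hA hk, ← q₁_profileOf h.share_nonneg hl (x := x),
      N.q₁_eq_groupPrice_of_card_lt hl hc, groupPrice_profileOf h.share_nonneg,
      h.sum_share l _ hk]

variable [Fintype Λ]

theorem tax_profileOf (η ξ : ℝ) (a : N.Agent) :
    N.tax η ξ (N.profileOf x μ) a = N.unitPrice μ a * N.alloc (N.profileOf x μ) a := by
  rw [tax, unitPrice, Finset.sum_mul]
  refine Finset.sum_congr rfl fun l hl => ?_
  have hk := N.mem_groupsOn_of_mem_route hl
  rw [linkTax_eq, h.chargedPrice_profileOf hA hl, mismatch_profileOf h.share_nonneg hl,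
    groupPrice_profileOf h.share_nonneg, h.sum_share l _ hk, h.otherPrice_profileOf hA hk,
    q₁_profileOf h.share_nonneg hl]
  ring

/-- With `δ` the change of the first price and `B` the bracket, the price-dependent part of the tax
is `δ² + δ B ≥ -B² / 4`; the mismatch penalty is dropped. -/
theorem le_linkTax_update {η ξ : ℝ} {a : N.Agent} (b : N.Message a) {l : Λ}
    (hl : l ∈ N.route a) :
    N.α l a * μ l a * N.alloc (Function.update (N.profileOf x μ) a b) a
      - (η * μ l a * (N.groupRate (Function.update (N.profileOf x μ) a b) l a.1
          - N.α l a * N.alloc (Function.update (N.profileOf x μ) a b) a)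
        + ξ * w l * N.slack (Function.update (N.profileOf x μ) a b) l) ^ 2 / 4
      ≤ N.linkTax η ξ (Function.update (N.profileOf x μ) a b) l a.1 a.2 := by
  have hk := N.mem_groupsOn_of_mem_route hl
  rw [N.linkTax_update _ a b η ξ hl, h.chargedPrice_profileOf hA hl,
    groupPrice_profileOf h.share_nonneg, h.sum_share l _ hk, h.otherPrice_profileOf hA hk,
    q₁_profileOf h.share_nonneg hl]
  have h0 : (0 : ℝ) ≤ if 2 ≤ (N.members l a.1).card then ((b.price₂ ⟨l, hl⟩ : ℝ)
      - N.q₁ (N.profileOf x μ) l ⟨a.1, N.next l a.1 a.2⟩) ^ 2 else 0 := by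
    split_ifs
    · exact sq_nonneg _
    · exact le_rfl
  have h1 := sq_nonneg (2 * ((b.price₁ ⟨l, hl⟩ : ℝ) - μ l a)
    + (η * μ l a * (N.groupRate (Function.update (N.profileOf x μ) a b) l a.1
          - N.α l a * N.alloc (Function.update (N.profileOf x μ) a b) a)
        + ξ * w l * N.slack (Function.update (N.profileOf x μ) a b) l))
  linarith

variable (hx : N.IsUnscaled x)
include hx

/-- The gain from a deviation is at most quadratic in the change of the agent's rate, with a factor
that vanishes with the tax constants. -/
theorem exists_unitPrice_sub_tax_le (a : N.Agent) :
    ∃ C, 0 ≤ C ∧ ∀ ε η ξ : ℝ, 0 < η → η < ε → 0 < ξ → ξ < ε → ∀ b : N.Message a,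
      N.unitPrice μ a * N.alloc (Function.update (N.profileOf x μ) a b) a
        - N.tax η ξ (Function.update (N.profileOf x μ) a b) a
      ≤ C * ε ^ 2 * (N.alloc (Function.update (N.profileOf x μ) a b) a - x a) ^ 2 := by
  -- Complementary slackness gives two cases: a zero share makes the product vanish for every
  -- deviation, and a zero gap at `x` is the hypothesis of `exists_gap_le`. The same dichotomy for
  -- link prices and slack follows.
  have hgap : ∀ l, ∃ C, 0 ≤ C ∧ (l ∈ N.route a → ∀ y, 0 ≤ y →
      μ l a * (N.scale (Function.update x a y) * N.groupMax l a.1 (Function.update x a y)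
        - N.α l a * (N.scale (Function.update x a y) * y))
        ≤ C * |N.scale (Function.update x a y) * y - x a|) := by
    intro l
    by_cases hl : l ∈ N.route a
    · rcases mul_eq_zero.mp (h.share_mul_gap a l hl) with h0 | h0
      · exact ⟨0, le_rfl, fun _ y _ => by rw [h0, zero_mul, zero_mul]⟩
      · obtain ⟨C, hC, hle⟩ := hx.exists_gap_le a hl (sub_eq_zero.mp h0)
        refine ⟨μ l a * C, mul_nonneg (h.share_nonneg l a) hC, fun _ y hy => ?_⟩
        rw [mul_assoc]
        exact mul_le_mul_of_nonneg_left (hle y hy) (h.share_nonneg l a)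
    · exact ⟨0, le_rfl, fun hl' => absurd hl' hl⟩
  have hslack : ∀ l, ∃ C, 0 ≤ C ∧ ∀ y, 0 ≤ y →
      w l * (N.c l - N.scale (Function.update x a y) * N.load l (Function.update x a y))
        ≤ C * |N.scale (Function.update x a y) * y - x a| := by
    intro l
    rcases mul_eq_zero.mp (h.price_mul_slack l) with h0 | h0
    · exact ⟨0, le_rfl, fun y _ => by rw [h0, zero_mul, zero_mul]⟩
    · obtain ⟨C, hC, hle⟩ := hx.exists_slack_le a (sub_eq_zero.mp h0).symm
      refine ⟨w l * C, mul_nonneg (h.price_nonneg l) hC, fun y hy => ?_⟩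
      rw [mul_assoc]
      exact mul_le_mul_of_nonneg_left (hle y hy) (h.price_nonneg l)
  choose C₁ hC₁ h₁ using hgap
  choose C₂ hC₂ h₂ using hslack
  refine ⟨∑ l ∈ N.route a, (C₁ l + C₂ l) ^ 2, Finset.sum_nonneg fun l _ => sq_nonneg _,
    fun ε η ξ hη hηε hξ hξε b => ?_⟩
  set s' := Function.update (N.profileOf x μ) a b with hs'
  have hd : N.demands s' = Function.update x a (b.demand : ℝ) := by
    rw [hs', demands_update, demands_profileOf hx.nonneg]
  have hy : (0 : ℝ) ≤ b.demand := b.demand.2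
  have halloc : N.alloc s' a = N.scale (Function.update x a (b.demand : ℝ)) * b.demand := by
    rw [alloc, hd, Function.update_self]
  rw [tax, unitPrice, Finset.sum_mul, ← Finset.sum_sub_distrib, Finset.sum_mul, Finset.sum_mul]
  refine Finset.sum_le_sum fun l hl => ?_
  have hlow := h.le_linkTax_update hA (η := η) (ξ := ξ) b hl
  rw [← hs'] at hlow
  have hg := h₁ l hl _ hy
  have hs := h₂ l _ hy
  rw [← halloc, ← hd] at hg hs
  rw [← N.slack_eq] at hs
  change μ l a * (N.groupRate s' l a.1 - N.α l a * N.alloc s' a) ≤ _ at hg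
  have hg0 := mul_nonneg (h.share_nonneg l a)
    (sub_nonneg.mpr (N.mul_alloc_le_groupRate s' a hl))
  have hs0 := mul_nonneg (h.price_nonneg l) (N.slack_nonneg s' l)
  set g := μ l a * (N.groupRate s' l a.1 - N.α l a * N.alloc s' a) with hgdef
  set t := w l * N.slack s' l with htdef
  have hB : η * μ l a * (N.groupRate s' l a.1 - N.α l a * N.alloc s' a)
      + ξ * w l * N.slack s' l = η * g + ξ * t := by rw [hgdef, htdef]; ring
  rw [hB] at hlow
  have hB0 : 0 ≤ η * g + ξ * t := by positivity
  have hB1 : η * g + ξ * t ≤ ε * ((C₁ l + C₂ l) * |N.alloc s' a - x a|) := by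
    have e1 : η * g ≤ ε * (C₁ l * |N.alloc s' a - x a|) :=
      mul_le_mul hηε.le hg hg0 (hη.le.trans hηε.le)
    have e2 : ξ * t ≤ ε * (C₂ l * |N.alloc s' a - x a|) :=
      mul_le_mul hξε.le hs hs0 (hη.le.trans hηε.le)
    linarith
  have hB2 := pow_le_pow_left₀ hB0 hB1 2
  have hB3 : (ε * ((C₁ l + C₂ l) * |N.alloc s' a - x a|)) ^ 2
      = (C₁ l + C₂ l) ^ 2 * ε ^ 2 * (N.alloc s' a - x a) ^ 2 := by
    rw [mul_pow, mul_pow, sq_abs]; ring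
  have hB4 := sq_nonneg (η * g + ξ * t)
  linarith

/-- For small tax constants, no deviation from the profile announcing optimal rates and prices is
profitable. -/
theorem exists_forall_utility_le {a : N.Agent} (hv : IsValuation (v a)) (h2 : secondDeriv (v a) (x a) < 0) :
    ∃ ε > 0, ∀ η ξ : ℝ, 0 < η → η < ε → 0 < ξ → ξ < ε → ∀ b : N.Message a,
      N.utility v η ξ (Function.update (N.profileOf x μ) a b) a
        ≤ N.utility v η ξ (N.profileOf x μ) a := by
  obtain ⟨l₀, hl₀⟩ := N.route_nonempty a
  obtain ⟨κ, hκ, hgrowth⟩ := exists_quadratic_growth hv (h.feasible.1 a) h2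
    (h.le_of_nonneg a) (N.c l₀ / N.α l₀ a)
  obtain ⟨C, hC, hle⟩ := h.exists_unitPrice_sub_tax_le hA hx a
  have hκC : 0 < κ / (C + 1) := by positivity
  -- Chosen so that `C ε² ≤ C ε ≤ κ`, which puts the tax saving below the quadratic loss; the `+ 1`
  -- allows `C = 0`.
  refine ⟨min 1 (κ / (C + 1)), lt_min one_pos hκC, fun η ξ hη hηε hξ hξε b => ?_⟩
  set ε := min 1 (κ / (C + 1))
  have hε0 : 0 < ε := lt_min one_pos hκC
  have hCε : C * ε ^ 2 ≤ κ := by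
    have e1 : ε ≤ 1 := min_le_left _ _
    have e2 : ε * (C + 1) ≤ κ := (le_div_iff₀ (by positivity)).mp (min_le_right _ _)
    have e3 : ε ^ 2 ≤ ε := by rw [sq]; exact mul_le_of_le_one_left hε0.le e1
    have e4 := mul_le_mul_of_nonneg_left e3 hC
    linarith
  have halloc : N.alloc (N.profileOf x μ) a = x a := by
    rw [alloc, demands_profileOf hx.nonneg, hx.scale_eq, one_mul]
  rw [utility, utility, h.tax_profileOf hA, halloc]
  have h3 := hle ε η ξ hη hηε hξ hξε b
  set s' := Function.update (N.profileOf x μ) a b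
  -- Quadratic growth is available only on a bounded interval; the capacity of a link on the route
  -- bounds every rate the mechanism can assign.
  have h4 := hgrowth (N.alloc s' a) (N.alloc_nonneg s' a) (by
    rw [le_div_iff₀' (N.α_pos a l₀ hl₀)]
    exact (N.mul_alloc_le_groupRate s' a hl₀).trans (N.groupRate_le s' a hl₀))
  have h5 := mul_le_mul_of_nonneg_right hCε (sq_nonneg (N.alloc s' a - x a))
  linarith

end IsKKT

end Equilibrium

end MulticastNetwork

/-! ### Conclusion. -/

theorem theorem1 {Λ : Type*} [Fintype Λ] [DecidableEq Λ] (N : MulticastNetwork Λ)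
    (v : N.Agent → ℝ → ℝ)
    (hv : ∀ a, MulticastNetwork.IsValuation (v a))
    (hA3 : ∀ l, 2 ≤ (N.groupsOn l).card)
    (hA4 : ∀ x, N.IsOptimalRates v x → ∀ l, 2 ≤ (N.support l x).card) :
    ∃ xs : N.Agent → ℝ,
      -- `xs` is the unique allocation that solves the centralised problem
      (∃ m, N.IsOptimal v xs m) ∧
      (∀ x m, N.IsOptimal v x m → x = xs) ∧
      -- every equilibrium yields `xs`, with individual rationality for all agents and the seller
      (∀ η ξ : ℝ, 0 < η → 0 < ξ → ∀ s : N.Profile, N.IsNash v η ξ s →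
        N.alloc s = xs ∧
        (∀ a, v a 0 ≤ N.utility v η ξ s a) ∧
        0 ≤ ∑ a, N.tax η ξ s a) ∧
      -- equilibria exist for all small enough tax constants
      ((∀ a, MulticastNetwork.secondDeriv (v a) (xs a) < 0) →
        ∃ ε : ℝ, 0 < ε ∧ ∀ η ξ : ℝ, 0 < η → η < ε → 0 < ξ → ξ < ε →
          ∃ s : N.Profile, N.IsNash v η ξ s) := by
  have hmono : ∀ a, StrictMonoOn (v a) (Set.Ici 0) := fun a => (hv a).1
  have hstrict : ∀ a, StrictConcaveOn ℝ (Set.Ici 0) (v a) := fun a => (hv a).2.1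
  have hconc : ∀ a, ConcaveOn ℝ (Set.Ici 0) (v a) := fun a => (hstrict a).concaveOn
  obtain ⟨xs, hxs⟩ := N.exists_isOptimalRates fun a => (hv a).2.2.continuousOn
  refine ⟨xs, ⟨_, N.isOptimal_groupMax hxs⟩,
    fun x m hxm => (N.isOptimalRates_of_isOptimal hxm).unique hstrict hxs,
    fun η ξ hη hξ s hs => ?_, fun h2 => ?_⟩
  · obtain ⟨w, hKKT⟩ := hs.exists_isKKT hη hξ hA3 hconc
    refine ⟨hKKT.isOptimalRates.unique hstrict hxs, fun a => ?_,
      Finset.sum_nonneg fun a _ => ?_⟩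
    · have h1 := hKKT.le_of_nonneg a 0 le_rfl
      rw [mul_zero, sub_zero] at h1
      rwa [MulticastNetwork.utility, hs.tax_eq hη hξ hA3]
    · rw [hs.tax_eq hη hξ hA3]
      exact mul_nonneg (Finset.sum_nonneg fun l hl =>
        mul_nonneg (N.α_pos a l hl).le (N.q₁_nonneg s l a)) (N.alloc_nonneg s a)
  · obtain ⟨w, μ, hKKT⟩ := hxs.exists_isKKT hconc
    -- Without agents the equilibrium condition is vacuous. With an agent there is a link on its
    -- route, which is needed for the scaling factor at the optimum to be `1`.
    rcases isEmpty_or_nonempty N.Agent with hempty | hne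
    · exact ⟨1, one_pos, fun η ξ _ _ _ _ => ⟨N.profileOf xs μ, fun a => hempty.elim a⟩⟩
    · have : Nonempty Λ := ⟨(N.route_nonempty (Classical.arbitrary N.Agent)).choose⟩
      have hunscaled : N.IsUnscaled xs :=
        ⟨hxs.1.1, hxs.1.2, hA4 xs hxs, hxs.scale_eq_one hmono (hA4 xs hxs)⟩
      choose ε hε hNash using fun a =>
        hKKT.exists_forall_utility_le hA3 hunscaled (hv a) (h2 a)
      obtain ⟨a₀, ha₀⟩ := Finite.exists_min ε
      exact ⟨ε a₀, hε a₀, fun η ξ hη hηε hξ hξε => ⟨N.profileOf xs μ, fun a b =>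
        hNash a η ξ hη (hηε.trans_le (ha₀ a)) hξ (hξε.trans_le (ha₀ a)) b⟩⟩
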